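/- Let $\mathcal F$ be a fan in $\mathbb R^n$ (lattice $\mathbb Z^n$) whose toric variety is projective, that is, $\mathcal F$ is the inner normal fan of a full-dimensional lattice polytope $P\subset\mathbb R^n$. Let $$\mathbb C_{\mathbb Q}=\varprojlim\mathbb C,\qquad \mathbb C^*_{\mathbb Q}=\varprojlim\mathbb C^*,\qquad S^1_{\mathbb Q}=\varprojlim S^1$$ be the inverse limits along the power maps $z\mapsto z^{l/k}$, $k\mid l$, over the positive integers ordered by divisibility. For a cone $\sigma$ let $S^\sigma=\sigma^\vee\cap\mathbb Z^n$, and for a commutative topological monoid $A$ put $F^{\mathcal F}(A)=\varinjlim_{\sigma\in\mathcal F}\mathrm{Hom}(S^\sigma,A)$ (unital semigroup homomorphisms, topology of pointwise convergence, colimit topology). Then $X^{\mathcal F}=F^{\mathcal F}(\mathbb C)$ is the toric variety, $X^{\mathcal F}_{\mathbb Q}=F^{\mathcal F}(\mathbb C_{\mathbb Q})$ its proalgebraic completion, $\mathrm{Delzant}(\mathcal F)=F^{\mathcal F}([0,\infty))$; let $q_1:X^{\mathcal F}_{\mathbb Q}\to X^{\mathcal F}$ be induced by $z\mapsto z_1$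 and the moment map $M:X^{\mathcal F}_{\mathbb Q}\to\mathrm{Delzant}(\mathcal F)$ by $z\mapsto|z_1|$. $\mathrm{Delzant}(\mathcal F)$ is identified with $P$ through $y\mapsto\sum_u\chi^u(y)\,u\big/\sum_u\chi^u(y)$, sums over $u\in P\cap\mathbb Z^n$; here, in the chart of $\sigma\in\mathcal F$, $\chi^u(y)=y(u-a)$ for any lattice point $a\in P$ minimizing all linear forms in $\sigma$ over $P$. For a ray $\rho$ of $\mathcal F$ let $D_\rho\subset X^{\mathcal F}$ be the closure of the torus orbit of $\rho$. The *singular divisors* of $X^{\mathcal F}_{\mathbb Q}$ are the sets $q_1^{-1}(D_\rho)$; the *cusps* are the points lying over the special point of a chart $\mathrm{Hom}(S^\sigma,\mathbb C)$, $\sigma\in\mathcal F$, i.e. over the homomorphism that vanishes on $S^\sigma\setminus\{0\}$, when this exists. 1. Let $Q$ be an $m$-dimensional face of $P$ with normal cone $\sigma$. The part of $X^{\mathcal F}_{\mathbb Q}$ that $M$ maps to the relative interior of $Q$ lies in the chart of $\sigma$ and is isomorphic to $(\mathbb C^*_{\mathbb Q})^m$: evaluation at some $\mathbb Z$-basis of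 $\sigma^\perp\cap\mathbb Z^n$ is a homeomorphism onto $(\mathbb C^*_{\mathbb Q})^m$. The fiber of $M$ over each single point of $\mathrm{Delzant}(\mathcal F)$ lying in the relative interior of $Q$ is homeomorphic to $(S^1_{\mathbb Q})^m$. 2. $Q\mapsto M^{-1}(Q)$ is a bijection from the faces of $P$ of codimension one onto the singular divisors of $X^{\mathcal F}_{\mathbb Q}$; the normal cone $\rho$ of such a $Q$ is a ray of $\mathcal F$, and $M^{-1}(Q)=q_1^{-1}(D_\rho)$. 3. $M$ restricts to a bijection from the cusps of $X^{\mathcal F}_{\mathbb Q}$ onto the vertices of $P$; in particular there are finitely many cusps, as many as $P$ has vertices. -/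

import Mathlib

open scoped NNReal

noncomputable section

namespace ProToric

/-! ### Inverse limits of the power maps -/

/-- The inverse limit of copies of `G` along the power maps `p_{n,m}(z) = z ^ (m / n)`, `n ∣ m`,
indexed by the positive integers ordered by divisibility (`m` is written as `n * k`). It carries
the pointwise product and the topology induced by the product topology. -/
def powLimit (G : Type) [CommMonoid G] : Submonoid (ℕ+ → G) where
  carrier := {z | ∀ n k : ℕ+, z (n * k) ^ (k : ℕ) = z n}
  one_mem' := by intro n k; simp
  mul_mem' := by
    intro a b ha hb n k
    simp only [Pi.mul_apply, mul_pow, ha n k, hb n k]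

/-- The projection of the inverse limit to its first level. -/
def powLimit.proj₁ (G : Type) [CommMonoid G] : powLimit G →* G where
  toFun z := z.1 1
  map_one' := rfl
  map_mul' _ _ := rfl

/-- Functoriality of the inverse limit. -/
def powLimit.map {G H : Type} [CommMonoid G] [CommMonoid H] (φ : G →* H) :
    powLimit G →* powLimit H where
  toFun z := ⟨fun n => φ (z.1 n), fun n k => by rw [← map_pow, z.2 n k]⟩
  map_one' := by ext n; simp
  map_mul' a b := by ext n; simp

/-- The semigroup `ℂ_ℚ = lim ℂ`. -/
abbrev CQ : Type := powLimit ℂ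

/-- The algebraic solenoidal group `ℂ*_ℚ = lim ℂ*`. -/
abbrev CQStar : Type := powLimit ℂˣ

/-- The adelic solenoid `S¹_ℚ = lim S¹`. -/
abbrev S1Q : Type := powLimit Circle

/-- The inclusion `ℂ*_ℚ → ℂ_ℚ`. -/
def CQStar.incl : CQStar →* CQ := powLimit.map (Units.coeHom ℂ)

/-- The quotient map `ℂ_ℚ → ℂ_ℚ / S¹_ℚ ≅ ℂ / S¹ ≅ [0, ∞)`, which is `z ↦ |z₁|`. -/
def CQ.abs : CQ →* ℝ≥0 := (nnnormHom : ℂ →*₀ ℝ≥0).toMonoidHom.comp (powLimit.proj₁ ℂ)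

/-! ### Cones and fans in `ℝⁿ` -/

variable {n : ℕ}

/-- An integer vector regarded as a real vector. -/
def toReal (u : Fin n → ℤ) : Fin n → ℝ := fun i => (u i : ℝ)

lemma toReal_add (u v : Fin n → ℤ) : toReal (u + v) = toReal u + toReal v := by
  ext i; simp [toReal]

lemma toReal_sub (u v : Fin n → ℤ) : toReal (u - v) = toReal u - toReal v := by
  ext i; simp [toReal]

lemma toReal_zero : toReal (0 : Fin n → ℤ) = 0 := by
  ext i; simp [toReal]

/-- `τ` is the face of the cone `σ` cut out by a supporting hyperplane `u^⊥`, `u ∈ σ^∨`. -/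
def IsConeFace (τ σ : PointedCone ℝ (Fin n → ℝ)) : Prop :=
  ∃ u : Fin n → ℝ, (∀ w ∈ σ, 0 ≤ u ⬝ᵥ w) ∧ ∀ w, w ∈ τ ↔ w ∈ σ ∧ u ⬝ᵥ w = 0

/-- A fan in `ℝⁿ` (with lattice `ℤⁿ`): a finite nonempty collection of strongly convex rational
polyhedral cones, closed under passing to faces, any two of which meet in a common face. -/
structure Fan (n : ℕ) where
  cones : Set (PointedCone ℝ (Fin n → ℝ))
  finite : cones.Finite
  nonempty : cones.Nonempty
  rational : ∀ σ ∈ cones, ∃ s : Finset (Fin n → ℤ), σ = PointedCone.hull ℝ (toReal '' (s : Set _))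
  salient : ∀ σ ∈ cones, ∀ w ∈ σ, -w ∈ σ → w = 0
  face_mem : ∀ σ ∈ cones, ∀ τ, IsConeFace τ σ → τ ∈ cones
  inter_face : ∀ σ ∈ cones, ∀ τ ∈ cones, IsConeFace (σ ⊓ τ) σ

/-- The dimension of a cone: the dimension of its linear span. -/
def coneDim (σ : PointedCone ℝ (Fin n → ℝ)) : ℕ :=
  Module.finrank ℝ (Submodule.span ℝ (σ : Set (Fin n → ℝ)))

/-- The rays of a fan: its one-dimensional cones. -/
def Fan.rays (F : Fan n) : Set (PointedCone ℝ (Fin n → ℝ)) := {ρ ∈ F.cones | coneDim ρ = 1}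

/-- The dual semigroup `S^σ = σ^∨ ∩ ℤⁿ`. -/
def dualSemigroup (σ : PointedCone ℝ (Fin n → ℝ)) : AddSubmonoid (Fin n → ℤ) where
  carrier := {u | ∀ w ∈ σ, 0 ≤ toReal u ⬝ᵥ w}
  zero_mem' := by intro w _; simp [toReal_zero]
  add_mem' := by
    intro a b ha hb w hw
    rw [toReal_add, add_dotProduct]
    exact add_nonneg (ha w hw) (hb w hw)

/-- The lattice `σ^⊥ ∩ ℤⁿ` of integer vectors orthogonal to `σ`. -/
def perpLattice (σ : PointedCone ℝ (Fin n → ℝ)) : AddSubgroup (Fin n → ℤ) where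
  carrier := {u | ∀ w ∈ σ, toReal u ⬝ᵥ w = 0}
  zero_mem' := by intro w _; simp [toReal_zero]
  add_mem' := by
    intro a b ha hb w hw
    rw [toReal_add, add_dotProduct, ha w hw, hb w hw, add_zero]
  neg_mem' := by
    intro a ha w hw
    have : toReal (-a) = -toReal a := by ext i; simp [toReal]
    rw [this, neg_dotProduct, ha w hw, neg_zero]

lemma perpLattice_le {σ : PointedCone ℝ (Fin n → ℝ)} {u : Fin n → ℤ} (hu : u ∈ perpLattice σ) :
    u ∈ dualSemigroup σ := fun w hw => (hu w hw).ge

lemma dualSemigroup_anti {τ σ : PointedCone ℝ (Fin n → ℝ)} (h : τ ≤ σ) :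
    dualSemigroup σ ≤ dualSemigroup τ := fun _ hu w hw => hu w (h hw)

/-! ### The toric functor -/

/-- `Hom_sg(S, A)`: homomorphisms of semigroups with unit from `(S, +)` to `(A, ·)`, with the
topology of pointwise convergence. -/
abbrev SgHom (S : AddSubmonoid (Fin n → ℤ)) (A : Type) [CommMonoid A] : Type :=
  {f : S → A // f 0 = 1 ∧ ∀ u v, f (u + v) = f u * f v}

/-- Restriction to a smaller semigroup. -/
def SgHom.restrict {S T : AddSubmonoid (Fin n → ℤ)} {A : Type} [CommMonoid A] (h : S ≤ T)
    (f : SgHom T A) : SgHom S A :=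
  ⟨fun u => f.1 ⟨u.1, h u.2⟩, f.2.1,
    fun u v => f.2.2 ⟨u.1, h u.2⟩ ⟨v.1, h v.2⟩⟩

/-- Postcomposition with a homomorphism. -/
def SgHom.comp {S : AddSubmonoid (Fin n → ℤ)} {A B : Type} [CommMonoid A] [CommMonoid B]
    (φ : A →* B) (f : SgHom S A) : SgHom S B :=
  ⟨fun u => φ (f.1 u), by simp only [f.2.1, map_one],
    fun u v => by simp only [f.2.2, map_mul]⟩

/-- The gluing relation: for `τ ⊆ σ` in the fan, `f ∈ Hom(S^τ, A)` is identified with its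
restriction in `Hom(S^σ, A)`. -/
def Fan.glue (F : Fan n) (A : Type) [CommMonoid A]
    (x y : Σ σ : F.cones, SgHom (dualSemigroup σ.1) A) : Prop :=
  ∃ h : x.1.1 ≤ y.1.1, y.2 = SgHom.restrict (dualSemigroup_anti h) x.2

/-- The toric functor `F(A) = colim_{σ ∈ F} Hom_sg(S^σ, A)`. -/
def Fan.Toric (F : Fan n) (A : Type) [CommMonoid A] : Type := Quot (F.glue A)

/-- The colimit topology. -/
instance (F : Fan n) (A : Type) [CommMonoid A] [TopologicalSpace A] :
    TopologicalSpace (F.Toric A) :=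
  inferInstanceAs (TopologicalSpace (Quot (F.glue A)))

/-- The canonical map of the affine chart `Hom_sg(S^σ, A)` to `F(A)`. -/
def Fan.chart (F : Fan n) {A : Type} [CommMonoid A] (σ : F.cones)
    (f : SgHom (dualSemigroup σ.1) A) : F.Toric A := Quot.mk _ ⟨σ, f⟩

/-- The toric functor on morphisms. -/
def Fan.map (F : Fan n) {A B : Type} [CommMonoid A] [CommMonoid B] (φ : A →* B) :
    F.Toric A → F.Toric B :=
  Quot.map (fun x => ⟨x.1, x.2.comp φ⟩) (by
    rintro ⟨τ, f⟩ ⟨σ, g⟩ ⟨h, hg⟩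
    exact ⟨h, congrArg (SgHom.comp φ) hg⟩)

/-- The complex toric variety `X^F = F(ℂ)`, with its classical topology. -/
abbrev Fan.X (F : Fan n) : Type := F.Toric ℂ

/-- The proalgebraic completion `X^F_ℚ = F(ℂ_ℚ)`. -/
abbrev Fan.XQ (F : Fan n) : Type := F.Toric CQ

/-- The space `Delzant(F) = F([0, ∞))`. -/
abbrev Fan.Delzant (F : Fan n) : Type := F.Toric ℝ≥0

/-- The solenoidization `q₁ : X^F_ℚ → X^F`. -/
def Fan.q₁ (F : Fan n) : F.XQ → F.X := F.map (powLimit.proj₁ ℂ)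

/-- The moment map `M : X^F_ℚ → Delzant(F)`. -/
def Fan.moment (F : Fan n) : F.XQ → F.Delzant := F.map CQ.abs

/-- The torus orbit `O_σ ⊆ X^F`: the points `f` of the chart of `σ` with `f u ≠ 0` exactly for
`u ∈ σ^⊥`. -/
def Fan.orbit (F : Fan n) (σ : PointedCone ℝ (Fin n → ℝ)) : Set F.X :=
  {x | ∃ (h : σ ∈ F.cones) (f : SgHom (dualSemigroup σ) ℂ),
    (∀ u, f.1 u ≠ 0 ↔ u.1 ∈ perpLattice σ) ∧ x = F.chart ⟨σ, h⟩ f}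

/-- The invariant divisor `D_ρ ⊆ X^F` of a ray `ρ`: the closure of the orbit `O_ρ`. -/
def Fan.divisor (F : Fan n) (ρ : PointedCone ℝ (Fin n → ℝ)) : Set F.X := closure (F.orbit ρ)

/-- The singular divisor of `X^F_ℚ` over the ramification divisor `D_ρ` of `q₁`. -/
def Fan.singularDivisor (F : Fan n) (ρ : PointedCone ℝ (Fin n → ℝ)) : Set F.XQ :=
  F.q₁ ⁻¹' F.divisor ρ

/-- The cusps of `X^F_ℚ`: the points over the special point of some affine chart
`X^σ = Hom_sg(S^σ, ℂ)`, that is, over the homomorphism that vanishes at every `u ≠ 0`. Such a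
homomorphism exists only if `0` is the only invertible element of `S^σ`, that is, if `σ` is
full-dimensional. -/
def Fan.cusps (F : Fan n) : Set F.XQ :=
  {x | ∃ (σ : F.cones) (p : SgHom (dualSemigroup σ.1) ℂ),
    (∀ u, u ≠ 0 → p.1 u = 0) ∧ F.q₁ x = F.chart σ p}

/-! ### Lattice polytopes -/

/-- A full-dimensional lattice polytope in `ℝⁿ`. -/
structure LatticePolytope (n : ℕ) where
  carrier : Set (Fin n → ℝ)
  exists_hull : ∃ s : Finset (Fin n → ℤ), carrier = convexHull ℝ (toReal '' (s : Set _))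
  full : (interior carrier).Nonempty

/-- `Q` is a (nonempty) face of `P` of dimension `m`. -/
def LatticePolytope.IsFace (P : LatticePolytope n) (m : ℕ) (Q : Set (Fin n → ℝ)) : Prop :=
  Q.Nonempty ∧ IsExposed ℝ P.carrier Q ∧ Module.finrank ℝ (vectorSpan ℝ Q) = m

/-- The inner normal cone of `Q ⊆ P`: the `w` such that `⟨·, w⟩` attains its minimum over `P` at
every point of `Q`. -/
def LatticePolytope.normalCone (P : LatticePolytope n) (Q : Set (Fin n → ℝ)) :
    PointedCone ℝ (Fin n → ℝ) where
  carrier := {w | ∀ u ∈ Q, ∀ v ∈ P.carrier, u ⬝ᵥ w ≤ v ⬝ᵥ w}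
  zero_mem' := by intro u _ v _; simp
  add_mem' := by
    intro a b ha hb u hu v hv
    rw [dotProduct_add, dotProduct_add]
    exact add_le_add (ha u hu v hv) (hb u hu v hv)
  smul_mem' := by
    intro c a ha u hu v hv
    have h : c • a = (c : ℝ) • a := rfl
    rw [h, dotProduct_smul, dotProduct_smul]
    exact mul_le_mul_of_nonneg_left (ha u hu v hv) c.2

/-- `F` is the normal fan of `P`: its cones are the normal cones of the nonempty faces of `P`. -/
def Fan.IsNormalFan (F : Fan n) (P : LatticePolytope n) : Prop :=
  F.cones = {σ | ∃ m Q, P.IsFace m Q ∧ σ = P.normalCone Q}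

/-- The lattice points of a lattice polytope are finite in number. -/
lemma LatticePolytope.finite_points (P : LatticePolytope n) :
    {u : Fin n → ℤ | toReal u ∈ P.carrier}.Finite := by
  obtain ⟨s, hs⟩ := P.exists_hull
  have hb : Bornology.IsBounded P.carrier := by
    rw [hs, isBounded_convexHull]
    exact (s.finite_toSet.image _).isBounded
  obtain ⟨R, hR⟩ := hb.exists_norm_le
  refine (Set.Finite.pi' (fun _ : Fin n => Set.finite_Icc (-⌈R⌉) ⌈R⌉)).subset ?_
  intro u hu i
  have h1 : |(u i : ℝ)| ≤ R := (norm_le_pi_norm (toReal u) i).trans (hR _ hu)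
  have h2 := (abs_le.1 (h1.trans (Int.le_ceil R)))
  exact ⟨by exact_mod_cast h2.1, by exact_mod_cast h2.2⟩

/-- The finite set `P ∩ ℤⁿ`. -/
def LatticePolytope.points (P : LatticePolytope n) : Finset (Fin n → ℤ) := P.finite_points.toFinset

/-- The lattice point `a` of `P` minimizes `⟨·, w⟩` over `P` for all `w ∈ σ`. -/
def LatticePolytope.IsMinAt (P : LatticePolytope n) (σ : PointedCone ℝ (Fin n → ℝ))
    (a : Fin n → ℤ) : Prop :=
  a ∈ P.points ∧ ∀ w ∈ σ, ∀ v ∈ P.carrier, toReal a ⬝ᵥ w ≤ v ⬝ᵥ w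

lemma LatticePolytope.exists_isMinAt (P : LatticePolytope n) {F : Fan n} (h : F.IsNormalFan P)
    (σ : F.cones) : ∃ a, P.IsMinAt σ.1 a := by
  obtain ⟨σ, hσ⟩ := σ
  have hσ' := hσ
  rw [show F.cones = _ from h] at hσ'
  obtain ⟨m, Q, ⟨⟨q, hq⟩, hE, -⟩, rfl⟩ := hσ'
  obtain ⟨l, hl⟩ := hE ⟨q, hq⟩
  obtain ⟨s, hs⟩ := P.exists_hull
  have hqP : q ∈ P.carrier := hE.subset hq
  have hne : s.Nonempty := by
    rw [Finset.nonempty_iff_ne_empty]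
    rintro rfl
    rw [hs] at hqP
    simp at hqP
  obtain ⟨a, has, ha⟩ := s.exists_max_image (fun u => l (toReal u)) hne
  have hmax : ∀ y ∈ P.carrier, l y ≤ l (toReal a) := by
    have hc : Convex ℝ {y | l y ≤ l (toReal a)} :=
      convex_halfSpace_le l.toLinearMap.isLinear _
    intro y hy
    rw [hs] at hy
    refine convexHull_min ?_ hc hy
    rintro _ ⟨u, hu, rfl⟩
    exact ha u hu
  have haP : toReal a ∈ P.carrier := by
    rw [hs]; exact subset_convexHull ℝ _ ⟨a, has, rfl⟩
  refine ⟨a, by simpa [points] using haP, fun w hw v hv => hw _ ?_ v hv⟩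
  rw [hl]
  exact ⟨haP, hmax⟩

/-- The value of `f ∈ Hom_sg(S, [0, ∞))` at an integer vector (used for vectors of `S` only). -/
def SgHom.val {S : AddSubmonoid (Fin n → ℤ)} (f : SgHom S ℝ≥0) (u : Fin n → ℤ) : ℝ :=
  open Classical in if h : u ∈ S then (f.1 ⟨u, h⟩ : ℝ) else 0

/-- The expression `(∑ χ^u(f) u) / (∑ χ^u(f))`, sums over `u ∈ P ∩ ℤⁿ`, with the characters
normalized at the lattice point `a`, that is, with `χ^u(f) = f (u - a)`. -/
def LatticePolytope.average (P : LatticePolytope n) {S : AddSubmonoid (Fin n → ℤ)}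
    (a : Fin n → ℤ) (f : SgHom S ℝ≥0) : Fin n → ℝ :=
  (∑ u ∈ P.points, f.val (u - a))⁻¹ • ∑ u ∈ P.points, f.val (u - a) • toReal u

lemma LatticePolytope.IsMinAt.sub_mem {P : LatticePolytope n} {σ : PointedCone ℝ (Fin n → ℝ)}
    {a : Fin n → ℤ} (ha : P.IsMinAt σ a) {u : Fin n → ℤ} (hu : u ∈ P.points) :
    u - a ∈ dualSemigroup σ := by
  intro w hw
  rw [toReal_sub, sub_dotProduct]
  have hu' : toReal u ∈ P.carrier := by simpa [points] using hu
  exact sub_nonneg.2 (ha.2 w hw _ hu')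

/-- The average does not depend on the normalization and is compatible with the gluing. -/
lemma LatticePolytope.average_restrict (P : LatticePolytope n)
    {τ σ : PointedCone ℝ (Fin n → ℝ)} (h : τ ≤ σ) {a b : Fin n → ℤ} (ha : P.IsMinAt τ a)
    (hb : P.IsMinAt σ b) (f : SgHom (dualSemigroup τ) ℝ≥0) :
    P.average a f = P.average b (f.restrict (dualSemigroup_anti h)) := by
  have hb' : P.IsMinAt τ b := ⟨hb.1, fun w hw => hb.2 w (h hw)⟩
  have hab : a - b ∈ dualSemigroup τ := hb'.sub_mem ha.1
  have hba : b - a ∈ dualSemigroup τ := ha.sub_mem hb.1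
  set c : ℝ := (f.1 ⟨a - b, hab⟩ : ℝ) with hc
  have hc0 : c ≠ 0 := by
    intro h0
    have h1 := f.2.2 ⟨a - b, hab⟩ ⟨b - a, hba⟩
    have h2 : (⟨a - b, hab⟩ + ⟨b - a, hba⟩ : dualSemigroup τ) = 0 := by
      ext1; simp
    rw [h2, f.2.1] at h1
    have h3 : f.1 ⟨a - b, hab⟩ = 0 := NNReal.coe_eq_zero.1 h0
    rw [h3, zero_mul] at h1
    exact one_ne_zero h1
  have key : ∀ u ∈ P.points,
      (f.restrict (dualSemigroup_anti h)).val (u - b) = c * f.val (u - a) := by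
    intro u hu
    have e1 : u - b ∈ dualSemigroup σ := hb.sub_mem hu
    have e2 : u - a ∈ dualSemigroup τ := ha.sub_mem hu
    rw [SgHom.val, SgHom.val, dif_pos e1, dif_pos e2, hc, ← NNReal.coe_mul, ← f.2.2]
    simp only [SgHom.restrict]
    congr 3
    ext1
    simp
  unfold average
  have key' : ∀ u ∈ P.points, (f.restrict (dualSemigroup_anti h)).val (u - b) • toReal u
      = c • (f.val (u - a) • toReal u) := fun u hu => by rw [key u hu, mul_smul]
  rw [Finset.sum_congr rfl key, Finset.sum_congr rfl key',
    ← Finset.mul_sum, ← Finset.smul_sum, smul_smul]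
  congr 1
  field_simp

/-- The identification of `Delzant(F)` with the polytope `P`, for the normal fan `F` of `P`: the
point `y` is sent to the weighted mean of the lattice points `u` of `P` with weights `χ^u(y)`. -/
def Fan.toPolytope (F : Fan n) (P : LatticePolytope n) (h : F.IsNormalFan P) :
    F.Delzant → Fin n → ℝ :=
  Quot.lift (fun x => P.average (P.exists_isMinAt h x.1).choose x.2) (by
    rintro ⟨τ, f⟩ ⟨σ, g⟩ ⟨hle, hg⟩
    have hle' : τ.1 ≤ σ.1 := hle
    have hg' : g = SgHom.restrict (dualSemigroup_anti hle') f := hg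
    subst hg'
    exact P.average_restrict hle' (P.exists_isMinAt h τ).choose_spec
      (P.exists_isMinAt h σ).choose_spec f)

/-- The moment map of `X^F_ℚ` with values in the polytope `P`. -/
def Fan.polytopeMoment (F : Fan n) (P : LatticePolytope n) (h : F.IsNormalFan P) :
    F.XQ → Fin n → ℝ := F.toPolytope P h ∘ F.moment

end ProToric

end

open scoped NNReal

noncomputable section

namespace ProToric

/-! ### Convex geometry of lattice polytopes, their faces and normal cones. -/

section

variable {n : ℕ}

/-! ### Relative interiors -/

section RelativeInterior

variable {E : Type*} [NormedAddCommGroup E] [NormedSpace ℝ E]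

/-! The proof matches two stratifications. For any commutative monoid `A`, the elements at which a
homomorphism on `S^σ` takes invertible values are those orthogonal to a face `τ` of `σ`
(`exists_cutsFace_isUnit_iff`). Since `S^τ` is obtained from `S^σ` by inverting one integer vector
that cuts out `τ`, the homomorphism extends uniquely to `S^τ`. Hence `F(A)` is the disjoint union of
strata indexed by the cones (`Fan.exists_mem_stratum`, `Fan.HasIntegralFaces.eq_of_mem_stratum`).
The maps `z ↦ z₁` and `z ↦ |z₁|` preserve and reflect invertibility, so `q₁` and the moment map
preserve and reflect strata.

On the stratum of the normal cone of `Q`, the weight of a lattice point of `P` is positive on `Q`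
and zero off it, so the weighted mean lies in the relative interior of `Q`. Relative interiors of
distinct faces are disjoint and the strata cover, so the part over the relative interior of `Q` is
exactly one stratum, and the part over `Q` is the union of the strata of the cones containing its
normal cone. That the weighted mean is a bijection onto `P` is never needed.

Statement 1: a non-invertible element of `ℂ_ℚ` is zero, so a point of a stratum is the same as its
values on a basis of the orthogonal lattice, whose rank is the dimension of `Q`. Charts are open
embeddings, which makes this a homeomorphism. Fixing the moduli leaves a product of solenoids, by
polar coordinates and uniqueness of positive roots.

Statement 2: the orbit closure of a ray is also the union of the strata of the cones containing it
(`Fan.HasIntegralFaces.mem_divisor_iff`), and `coneDim_add` pairs facets with rays. Statement 3: a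
special point exists only if the orthogonal lattice is zero, which means that the face is a vertex,
and then the stratum is a single point. -/

lemma mem_intrinsicInterior_iff_dist {s : Set E} {x : E} :
    x ∈ intrinsicInterior ℝ s ↔
      x ∈ s ∧ ∃ r > 0, ∀ z ∈ affineSpan ℝ s, dist z x < r → z ∈ s := by
  constructor
  · intro hx
    refine ⟨intrinsicInterior_subset hx, ?_⟩
    obtain ⟨y, hy, rfl⟩ := mem_intrinsicInterior.1 hx
    obtain ⟨r, hr, h⟩ := Metric.mem_nhds_iff.1 (mem_interior_iff_mem_nhds.1 hy)
    exact ⟨r, hr, fun z hz hzr => h (show (⟨z, hz⟩ : affineSpan ℝ s) ∈ Metric.ball y r from hzr)⟩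
  · rintro ⟨hx, r, hr, h⟩
    refine mem_intrinsicInterior.2 ⟨⟨x, subset_affineSpan ℝ s hx⟩, ?_, rfl⟩
    rw [mem_interior_iff_mem_nhds, Metric.mem_nhds_iff]
    exact ⟨r, hr, fun z hz => h z.1 z.2 hz⟩

/-- A point on the open segment from a relative interior point of a convex set to another point
of the set is a relative interior point. -/
lemma combo_mem_intrinsicInterior {s : Set E} (hs : Convex ℝ s) {p q : E}
    (hp : p ∈ intrinsicInterior ℝ s) (hq : q ∈ s) {t : ℝ} (ht : 0 < t) (ht1 : t ≤ 1) :
    t • p + (1 - t) • q ∈ intrinsicInterior ℝ s := by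
  obtain ⟨hps, r, hr, h⟩ := mem_intrinsicInterior_iff_dist.1 hp
  have hx : t • p + (1 - t) • q ∈ s := hs hps hq ht.le (by linarith) (by ring)
  refine mem_intrinsicInterior_iff_dist.2 ⟨hx, t * r, by positivity, fun z hz hzr => ?_⟩
  set x := t • p + (1 - t) • q with hxdef
  -- The homothety with centre `q` and ratio `t⁻¹` takes `x` to `p` and `z` to this point, which is
  -- within `r` of `p`.
  have hp' : p + t⁻¹ • (z - x) ∈ s := by
    refine h _ ?_ ?_
    · have hd : z - x ∈ (affineSpan ℝ s).direction :=
        AffineSubspace.vsub_mem_direction hz (subset_affineSpan ℝ s hx)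
      have := AffineSubspace.vadd_mem_of_mem_direction
        (Submodule.smul_mem _ t⁻¹ hd) (subset_affineSpan ℝ s hps)
      simpa [add_comm] using this
    · rw [dist_eq_norm, add_sub_cancel_left, norm_smul, norm_inv, Real.norm_of_nonneg ht.le]
      rw [dist_eq_norm] at hzr
      rw [inv_mul_lt_iff₀ ht]
      exact hzr
  have hz' : z = t • (p + t⁻¹ • (z - x)) + (1 - t) • q := by
    rw [smul_add, smul_smul, mul_inv_cancel₀ ht.ne', one_smul, hxdef]
    abel
  rw [hz']
  exact hs hp' hq ht.le (by linarith) (by ring)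

/-- A convex combination of finitely many points with positive weights lies in the relative
interior of their convex hull. -/
lemma sum_mem_intrinsicInterior [FiniteDimensional ℝ E] (T : Finset E) (c : E → ℝ)
    (hc : ∀ y ∈ T, 0 < c y) (hc1 : ∑ y ∈ T, c y = 1) :
    ∑ y ∈ T, c y • y ∈ intrinsicInterior ℝ (convexHull ℝ (T : Set E)) := by
  have hT : T.Nonempty := by
    rw [Finset.nonempty_iff_ne_empty]
    rintro rfl
    simp at hc1
  have hconv := convex_convexHull ℝ (T : Set E)
  obtain ⟨p, hp⟩ := Set.Nonempty.intrinsicInterior hconv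
    (hT.to_set.mono (subset_convexHull ℝ (T : Set E)))
  obtain ⟨d, hd0, hd1, hdp⟩ := Finset.mem_convexHull'.1 (intrinsicInterior_subset hp)
  obtain ⟨y₀, hy₀⟩ := hT
  set ε := T.inf' ⟨y₀, hy₀⟩ c with hε
  have hεpos : 0 < ε := (Finset.lt_inf'_iff _).2 hc
  have hεle : ∀ y ∈ T, ε ≤ c y := fun y hy => Finset.inf'_le _ hy
  have hε1 : ε ≤ 1 := (hεle _ hy₀).trans
    (hc1 ▸ Finset.single_le_sum (fun y hy => (hc y hy).le) hy₀)
  -- Half the least weight: as `d y ≤ 1`, a multiple `t` of `p` can be split off with nonnegative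
  -- remaining weights.
  set t := ε / 2 with ht
  have ht0 : 0 < t := by positivity
  have ht1 : t < 1 := by linarith
  have hd_le : ∀ y ∈ T, d y ≤ 1 := fun y hy => hd1 ▸ Finset.single_le_sum hd0 hy
  have hq : ∑ y ∈ T, ((1 - t)⁻¹ * (c y - t * d y)) • y ∈ convexHull ℝ (T : Set E) := by
    refine hconv.sum_mem (fun y hy => ?_) ?_ (fun y hy => subset_convexHull ℝ _ hy)
    · have := hεle y hy
      have := hd_le y hy
      refine mul_nonneg (inv_nonneg.2 (by linarith)) ?_
      nlinarith
    · rw [← Finset.mul_sum, Finset.sum_sub_distrib, ← Finset.mul_sum, hc1, hd1, mul_one,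
        inv_mul_cancel₀ (by linarith)]
  have key := combo_mem_intrinsicInterior hconv hp hq ht0 ht1.le
  convert key using 1
  rw [← hdp, Finset.smul_sum, Finset.smul_sum, ← Finset.sum_add_distrib]
  refine Finset.sum_congr rfl fun y _ => ?_
  rw [smul_smul, smul_smul, ← add_smul, mul_inv_cancel_left₀ (by linarith)]
  congr 1
  ring

end RelativeInterior

/-- A linear form that attains its minimum over `s` at a relative interior point is constant
on `s`. -/
lemma dotProduct_eq_of_mem_intrinsicInterior {s : Set (Fin n → ℝ)} {x w : Fin n → ℝ}
    (hx : x ∈ intrinsicInterior ℝ s) (hmin : ∀ z ∈ s, x ⬝ᵥ w ≤ z ⬝ᵥ w) {z : Fin n → ℝ}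
    (hz : z ∈ s) : z ⬝ᵥ w = x ⬝ᵥ w := by
  obtain ⟨hxs, r, hr, h⟩ := mem_intrinsicInterior_iff_dist.1 hx
  refine le_antisymm ?_ (hmin z hz)
  -- A step from `x` directly away from `z`, shorter than `r`; the summand `1` covers the case `x =
  -- z`.
  set t := r / (2 * (1 + ‖x - z‖)) with ht
  have hpos : 0 < 1 + ‖x - z‖ := by positivity
  have ht0 : 0 < t := by positivity
  have hy : x + t • (x - z) ∈ s := by
    refine h _ ?_ ?_
    · have hd : x - z ∈ (affineSpan ℝ s).direction :=
        AffineSubspace.vsub_mem_direction (subset_affineSpan ℝ s hxs) (subset_affineSpan ℝ s hz)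
      have := AffineSubspace.vadd_mem_of_mem_direction
        (Submodule.smul_mem _ t hd) (subset_affineSpan ℝ s hxs)
      simpa [add_comm] using this
    · rw [dist_eq_norm, add_sub_cancel_left, norm_smul, Real.norm_of_nonneg ht0.le, ht,
        div_mul_eq_mul_div, div_lt_iff₀ (by positivity)]
      nlinarith [norm_nonneg (x - z)]
  have := hmin _ hy
  rw [add_dotProduct, smul_dotProduct, sub_dotProduct, smul_eq_mul] at this
  nlinarith

/-! ### Faces of lattice polytopes -/

lemma exists_dotProduct_eq (l : (Fin n → ℝ) →ₗ[ℝ] ℝ) : ∃ w : Fin n → ℝ, ∀ x, l x = x ⬝ᵥ w :=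
  ⟨fun i => l (Pi.single i 1), fun x => by
    rw [LinearMap.pi_apply_eq_sum_univ l x]
    simp only [dotProduct, smul_eq_mul]
    refine Finset.sum_congr rfl fun i _ => ?_
    congr 2
    ext j
    simp [Pi.single_apply, eq_comm]⟩

lemma toReal_injective : Function.Injective (toReal (n := n)) := fun u v h => by
  ext i
  exact Int.cast_injective (α := ℝ) (congrFun h i)

/-- `toReal` as a homomorphism of groups. -/
def toRealHom : (Fin n → ℤ) →+ (Fin n → ℝ) where
  toFun := toReal
  map_zero' := toReal_zero
  map_add' := toReal_add

lemma toReal_sum {ι : Type*} (s : Finset ι) (u : ι → Fin n → ℤ) :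
    toReal (∑ i ∈ s, u i) = ∑ i ∈ s, toReal (u i) := map_sum toRealHom u s

lemma toReal_dotProduct_toReal (u v : Fin n → ℤ) :
    toReal u ⬝ᵥ toReal v = ((u ⬝ᵥ v : ℤ) : ℝ) := by
  simp [toReal, dotProduct]

namespace LatticePolytope

variable {P : LatticePolytope n} {m m' : ℕ} {Q Q' : Set (Fin n → ℝ)}

lemma mem_points {u : Fin n → ℤ} : u ∈ P.points ↔ toReal u ∈ P.carrier := by
  simp [points]

lemma convex (P : LatticePolytope n) : Convex ℝ P.carrier := by
  obtain ⟨s, hs⟩ := P.exists_hull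
  exact hs ▸ convex_convexHull ℝ _

lemma carrier_eq (P : LatticePolytope n) :
    P.carrier = convexHull ℝ (toReal '' (P.points : Set (Fin n → ℤ))) := by
  apply subset_antisymm
  · obtain ⟨s, hs⟩ := P.exists_hull
    have h : toReal '' (s : Set (Fin n → ℤ)) ⊆ P.carrier := hs ▸ subset_convexHull ℝ _
    conv_lhs => rw [hs]
    refine convexHull_mono ?_
    rintro _ ⟨u, hu, rfl⟩
    exact ⟨u, mem_points.2 (h ⟨u, hu, rfl⟩), rfl⟩
  · refine convexHull_min ?_ P.convex
    rintro _ ⟨u, hu, rfl⟩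
    exact mem_points.1 hu

lemma le_dotProduct_of_points {c : ℝ} {w : Fin n → ℝ}
    (h : ∀ u ∈ P.points, c ≤ toReal u ⬝ᵥ w) : ∀ v ∈ P.carrier, c ≤ v ⬝ᵥ w := by
  intro v hv
  have hc : Convex ℝ {v : Fin n → ℝ | c ≤ v ⬝ᵥ w} :=
    convex_halfSpace_ge ⟨fun x y => add_dotProduct x y w, fun a x => smul_dotProduct a x w⟩ c
  rw [P.carrier_eq] at hv
  refine convexHull_min ?_ hc hv
  rintro _ ⟨u, hu, rfl⟩
  exact h u hu

lemma IsFace.subset (hQ : P.IsFace m Q) : Q ⊆ P.carrier := hQ.2.1.subset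

lemma IsFace.convex (hQ : P.IsFace m Q) : Convex ℝ Q := hQ.2.1.convex P.convex

/-- All linear forms in the normal cone are constant on the face. -/
lemma IsFace.dotProduct_eq (hQ : P.IsFace m Q) {w x y : Fin n → ℝ} (hw : w ∈ P.normalCone Q)
    (hx : x ∈ Q) (hy : y ∈ Q) : x ⬝ᵥ w = y ⬝ᵥ w :=
  le_antisymm (hw x hx y (hQ.subset hy)) (hw y hy x (hQ.subset hx))

/-- The negative of an exposing functional is a normal vector whose minimum is attained on `Q` only.
All comparisons of faces rest on such a vector. -/
lemma IsFace.exists_normal (hQ : P.IsFace m Q) : ∃ w ∈ P.normalCone Q,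
    ∀ x ∈ P.carrier, ∀ q ∈ Q, x ⬝ᵥ w ≤ q ⬝ᵥ w → x ∈ Q := by
  obtain ⟨l, hl⟩ := hQ.2.1 hQ.1
  obtain ⟨w, hw⟩ := exists_dotProduct_eq (-l.toLinearMap)
  have hw' : ∀ x, l x = -(x ⬝ᵥ w) := fun x => by
    rw [← hw x]; simp
  refine ⟨w, fun u hu v hv => ?_, fun x hx q hq hxq => ?_⟩
  · rw [hl] at hu
    have := hu.2 v hv
    rw [hw', hw'] at this
    linarith
  · rw [hl] at hq ⊢
    refine ⟨hx, fun y hy => ?_⟩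
    have := hq.2 y hy
    rw [hw'] at this ⊢
    rw [hw'] at this ⊢
    linarith

/-- The lattice points of a face. -/
def facePoints (P : LatticePolytope n) (Q : Set (Fin n → ℝ)) : Finset (Fin n → ℤ) :=
  open Classical in P.points.filter fun u => toReal u ∈ Q

lemma mem_facePoints {u : Fin n → ℤ} : u ∈ P.facePoints Q ↔ u ∈ P.points ∧ toReal u ∈ Q := by
  simp [facePoints]

lemma IsFace.mem_facePoints (hQ : P.IsFace m Q) {u : Fin n → ℤ} :
    u ∈ P.facePoints Q ↔ toReal u ∈ Q := by
  rw [LatticePolytope.mem_facePoints, and_iff_right_iff_imp]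
  exact fun h => mem_points.2 (hQ.subset h)

/-- A face is the convex hull of its lattice points. -/
lemma IsFace.eq_convexHull (hQ : P.IsFace m Q) :
    Q = convexHull ℝ ((P.facePoints Q).image toReal : Set (Fin n → ℝ)) := by
  classical
  apply subset_antisymm
  · intro x hx
    obtain ⟨w, hw, hwQ⟩ := hQ.exists_normal
    have hxP := hQ.subset hx
    rw [P.carrier_eq, ← Finset.coe_image] at hxP
    obtain ⟨c, hc0, hc1, hcx⟩ := Finset.mem_convexHull'.1 hxP
    have hmem : ∀ y ∈ P.points.image toReal, y ∈ P.carrier := by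
      intro y hy
      obtain ⟨u, hu, rfl⟩ := Finset.mem_image.1 hy
      exact mem_points.1 hu
    -- The terms are nonnegative, so a lattice point of nonzero weight has the minimal value of `w`
    -- and lies in `Q`.
    have hsum : ∑ y ∈ P.points.image toReal, c y * (y ⬝ᵥ w - x ⬝ᵥ w) = 0 := by
      have h1 : ∑ y ∈ P.points.image toReal, c y * (y ⬝ᵥ w) = x ⬝ᵥ w := by
        conv_rhs => rw [← hcx, sum_dotProduct]
        simp only [smul_dotProduct, smul_eq_mul]
      simp only [mul_sub, Finset.sum_sub_distrib, h1, ← Finset.sum_mul, hc1, one_mul, sub_self]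
    rw [Finset.sum_eq_zero_iff_of_nonneg
      (fun y hy => mul_nonneg (hc0 y hy) (sub_nonneg.2 (hw x hx y (hmem y hy))))] at hsum
    have hzero : ∀ y ∈ P.points.image toReal, y ∉ (P.facePoints Q).image toReal → c y = 0 := by
      intro y hy hyQ
      rcases mul_eq_zero.1 (hsum y hy) with h | h
      · exact h
      · refine absurd ?_ hyQ
        obtain ⟨u, hu, rfl⟩ := Finset.mem_image.1 hy
        exact Finset.mem_image_of_mem _ (LatticePolytope.mem_facePoints.2
          ⟨hu, hwQ _ (hmem _ hy) x hx (by linarith)⟩)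
    have hsub : (P.facePoints Q).image toReal ⊆ P.points.image toReal :=
      Finset.image_subset_image (Finset.filter_subset _ _)
    rw [← hcx, ← Finset.sum_subset hsub (fun y hy hyn => by rw [hzero y hy hyn, zero_smul])]
    refine (convex_convexHull ℝ _).sum_mem (fun y hy => hc0 y (hsub hy)) ?_
      (fun y hy => subset_convexHull ℝ _ hy)
    rw [← hc1]
    exact Finset.sum_subset hsub hzero
  · refine convexHull_min ?_ hQ.convex
    intro y hy
    obtain ⟨u, hu, rfl⟩ := Finset.mem_image.1 (Finset.mem_coe.1 hy)
    exact hQ.mem_facePoints.1 hu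

lemma IsFace.facePoints_nonempty (hQ : P.IsFace m Q) : (P.facePoints Q).Nonempty := by
  have h := hQ.1
  rw [hQ.eq_convexHull, convexHull_nonempty_iff] at h
  simpa using h

lemma IsFace.mem_normalCone_of_facePoints (hQ : P.IsFace m Q) {w : Fin n → ℝ}
    (h : ∀ u ∈ P.facePoints Q, ∀ v ∈ P.carrier, toReal u ⬝ᵥ w ≤ v ⬝ᵥ w) :
    w ∈ P.normalCone Q := by
  intro x hx v hv
  have hc : Convex ℝ {x : Fin n → ℝ | x ⬝ᵥ w ≤ v ⬝ᵥ w} :=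
    convex_halfSpace_le ⟨fun x y => add_dotProduct x y w, fun a x => smul_dotProduct a x w⟩ _
  rw [hQ.eq_convexHull] at hx
  refine convexHull_min ?_ hc hx
  intro y hy
  obtain ⟨u, hu, rfl⟩ := Finset.mem_image.1 (Finset.mem_coe.1 hy)
  exact h u hu v hv

lemma IsFace.isMinAt_iff (hQ : P.IsFace m Q) {a : Fin n → ℤ} :
    P.IsMinAt (P.normalCone Q) a ↔ toReal a ∈ Q := by
  constructor
  · rintro ⟨ha, h⟩
    obtain ⟨w, hw, hwQ⟩ := hQ.exists_normal
    obtain ⟨q, hq⟩ := hQ.1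
    exact hwQ _ (mem_points.1 ha) q hq (h w hw q (hQ.subset hq))
  · intro ha
    exact ⟨mem_points.2 (hQ.subset ha), fun w hw v hv => hw _ ha v hv⟩

/-- A lattice point `u` of `P` lies in `Q` iff `u - a` is orthogonal to the normal cone of `Q`. -/
lemma IsFace.sub_mem_perpLattice_iff (hQ : P.IsFace m Q) {a u : Fin n → ℤ} (ha : toReal a ∈ Q)
    (hu : u ∈ P.points) : u - a ∈ perpLattice (P.normalCone Q) ↔ toReal u ∈ Q := by
  constructor
  · intro h
    obtain ⟨w, hw, hwQ⟩ := hQ.exists_normal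
    have := h w hw
    rw [toReal_sub, sub_dotProduct] at this
    exact hwQ _ (mem_points.1 hu) _ ha (by linarith)
  · intro h w hw
    rw [toReal_sub, sub_dotProduct, hQ.dotProduct_eq hw h ha, sub_self]

lemma IsFace.normalCone_le_iff (hQ : P.IsFace m Q) (hQ' : P.IsFace m' Q') :
    P.normalCone Q' ≤ P.normalCone Q ↔ Q ⊆ Q' := by
  constructor
  · intro h x hx
    obtain ⟨w, hw, hwQ⟩ := hQ'.exists_normal
    obtain ⟨q, hq⟩ := hQ'.1
    exact hwQ x (hQ.subset hx) q hq (h hw x hx q (hQ'.subset hq))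
  · exact fun h w hw x hx => hw x (h hx)

/-- A face that meets the relative interior of `Q` contains `Q`. -/
lemma IsFace.subset_of_mem_intrinsicInterior (hQ : P.IsFace m Q) (hQ' : P.IsFace m' Q')
    {x : Fin n → ℝ} (hx : x ∈ intrinsicInterior ℝ Q) (hx' : x ∈ Q') : Q ⊆ Q' := by
  intro z hz
  obtain ⟨w, hw, hwQ⟩ := hQ'.exists_normal
  refine hwQ z (hQ.subset hz) x hx' (le_of_eq ?_)
  exact dotProduct_eq_of_mem_intrinsicInterior hx (fun y hy => hw x hx' y (hQ.subset hy)) hz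

lemma IsFace.eq_of_mem_intrinsicInterior (hQ : P.IsFace m Q) (hQ' : P.IsFace m' Q')
    {x : Fin n → ℝ} (hx : x ∈ intrinsicInterior ℝ Q) (hx' : x ∈ intrinsicInterior ℝ Q') : Q = Q' :=
  subset_antisymm (hQ.subset_of_mem_intrinsicInterior hQ' hx (intrinsicInterior_subset hx'))
    (hQ'.subset_of_mem_intrinsicInterior hQ hx' (intrinsicInterior_subset hx))

/-! ### Dimensions of normal cones -/

/-- Near a linear form exposing `Q`, the forms that are constant on `Q` lie in the normal cone. -/
lemma IsFace.exists_add_smul_mem (hQ : P.IsFace m Q) {w₀ w : Fin n → ℝ}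
    (hw₀ : w₀ ∈ P.normalCone Q) (hw₀Q : ∀ x ∈ P.carrier, ∀ q ∈ Q, x ⬝ᵥ w₀ ≤ q ⬝ᵥ w₀ → x ∈ Q)
    (hw : ∀ x ∈ Q, ∀ y ∈ Q, x ⬝ᵥ w = y ⬝ᵥ w) : ∃ ε > (0 : ℝ), w₀ + ε • w ∈ P.normalCone Q := by
  obtain ⟨q, hq⟩ := hQ.1
  -- Only finitely many inequalities: they are equalities on `Q`, and off `Q` they are strict at `ε
  -- = 0`, hence persist.
  have hev : ∀ᶠ ε : ℝ in nhdsWithin 0 (Set.Ioi 0), ∀ u ∈ P.points,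
      q ⬝ᵥ (w₀ + ε • w) ≤ toReal u ⬝ᵥ (w₀ + ε • w) := by
    rw [Filter.eventually_all_finset]
    intro u hu
    by_cases huQ : toReal u ∈ Q
    · refine Filter.Eventually.of_forall fun ε => ?_
      rw [dotProduct_add, dotProduct_add, dotProduct_smul, dotProduct_smul,
        hQ.dotProduct_eq hw₀ hq huQ, hw q hq _ huQ]
    · have hlt : q ⬝ᵥ w₀ < toReal u ⬝ᵥ w₀ := by
        by_contra hle
        exact huQ (hw₀Q _ (mem_points.1 hu) q hq (not_lt.1 hle))
      have hcont : ∀ v : Fin n → ℝ, Continuous fun ε : ℝ => v ⬝ᵥ (w₀ + ε • w) := fun v => by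
        simp only [dotProduct_add, dotProduct_smul, smul_eq_mul]
        fun_prop
      have := (hcont q).continuousAt.eventually_lt (x₀ := 0) (hcont (toReal u)).continuousAt
        (by simpa using hlt)
      exact (this.filter_mono nhdsWithin_le_nhds).mono fun _ h => h.le
  obtain ⟨ε, hε, hε0⟩ := (hev.and self_mem_nhdsWithin).exists
  refine ⟨ε, hε0, fun x hx v hv => ?_⟩
  have hxq : x ⬝ᵥ (w₀ + ε • w) = q ⬝ᵥ (w₀ + ε • w) := by
    rw [dotProduct_add, dotProduct_add, dotProduct_smul, dotProduct_smul,
        hQ.dotProduct_eq hw₀ hq hx, hw q hq _ hx]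
  rw [hxq]
  exact le_dotProduct_of_points hε v hv

lemma dotProduct_eq_zero_of_mem_vectorSpan {w v : Fin n → ℝ}
    (hw : ∀ x ∈ Q, ∀ y ∈ Q, x ⬝ᵥ w = y ⬝ᵥ w) (hv : v ∈ vectorSpan ℝ Q) : v ⬝ᵥ w = 0 := by
  rw [vectorSpan_def] at hv
  induction hv using Submodule.span_induction with
  | mem x hx =>
    obtain ⟨a, ha, b, hb, rfl⟩ := hx
    change (a - b) ⬝ᵥ w = 0
    rw [sub_dotProduct, hw a ha b hb, sub_self]
  | zero => simp
  | add x y _ _ hx hy => rw [add_dotProduct, hx, hy, add_zero]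
  | smul a x _ hx => rw [smul_dotProduct, hx, smul_zero]

/-- The span of the normal cone consists of the forms that are constant on the face. -/
lemma IsFace.mem_span_normalCone_iff (hQ : P.IsFace m Q) {w : Fin n → ℝ} :
    w ∈ Submodule.span ℝ (P.normalCone Q : Set (Fin n → ℝ)) ↔
      ∀ x ∈ Q, ∀ y ∈ Q, x ⬝ᵥ w = y ⬝ᵥ w := by
  constructor
  · intro hw x hx y hy
    induction hw using Submodule.span_induction with
    | mem w hw => exact hQ.dotProduct_eq hw hx hy
    | zero => simp
    | add a b _ _ ha hb => rw [dotProduct_add, dotProduct_add, ha, hb]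
    | smul c a _ ha => rw [dotProduct_smul, dotProduct_smul, ha]
  · intro hw
    obtain ⟨w₀, hw₀, hw₀Q⟩ := hQ.exists_normal
    obtain ⟨ε, hε, h⟩ := hQ.exists_add_smul_mem hw₀ hw₀Q hw
    have : w = ε⁻¹ • ((w₀ + ε • w) - w₀) := by
      rw [add_sub_cancel_left, smul_smul, inv_mul_cancel₀ hε.ne', one_smul]
    rw [this]
    exact Submodule.smul_mem _ _ (Submodule.sub_mem _ (Submodule.subset_span h)
      (Submodule.subset_span hw₀))

/-- The span of the normal cone is the annihilator of the direction of the face. -/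
lemma IsFace.coneDim_add (hQ : P.IsFace m Q) : coneDim (P.normalCone Q) + m = n := by
  have hspan : Submodule.span ℝ (P.normalCone Q : Set (Fin n → ℝ)) =
      (vectorSpan ℝ Q).dualAnnihilator.map (dotProductEquiv ℝ (Fin n)).symm.toLinearMap := by
    ext w
    rw [hQ.mem_span_normalCone_iff, Submodule.mem_map_equiv, LinearEquiv.symm_symm,
      Submodule.mem_dualAnnihilator]
    simp only [dotProductEquiv_apply_apply]
    constructor
    · intro h v hv
      rw [dotProduct_comm]
      exact dotProduct_eq_zero_of_mem_vectorSpan h hv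
    · intro h x hx y hy
      have := h (x - y) (vsub_mem_vectorSpan ℝ hx hy)
      rw [dotProduct_comm, sub_dotProduct] at this
      linarith
  have h1 := Subspace.finrank_add_finrank_dualAnnihilator_eq (vectorSpan ℝ Q)
  rw [coneDim, hspan, LinearEquiv.finrank_map_eq]
  rw [hQ.2.2, Module.finrank_fin_fun] at h1
  omega

/-- The orthogonal space of the normal cone of a face is the direction of the face. -/
lemma IsFace.mem_vectorSpan (hQ : P.IsFace m Q) {v : Fin n → ℝ}
    (hv : ∀ w ∈ P.normalCone Q, v ⬝ᵥ w = 0) : v ∈ vectorSpan ℝ Q := by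
  -- A form vanishing on the direction of `Q` but not at `v` would lie in the span of the normal
  -- cone, which `v` annihilates.
  by_contra hn
  obtain ⟨l, hl, hker⟩ := Submodule.exists_le_ker_of_notMem hn
  obtain ⟨w, hw⟩ := exists_dotProduct_eq l
  have hwQ : w ∈ Submodule.span ℝ (P.normalCone Q : Set (Fin n → ℝ)) := by
    refine hQ.mem_span_normalCone_iff.2 fun x hx y hy => ?_
    have := hker (vsub_mem_vectorSpan ℝ hx hy)
    rw [LinearMap.mem_ker, hw, vsub_eq_sub, sub_dotProduct] at this
    linarith
  apply hl
  rw [hw]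
  clear hw
  induction hwQ using Submodule.span_induction with
  | mem w hw => exact hv w hw
  | zero => simp
  | add a b _ _ ha hb => rw [dotProduct_add, ha, hb, add_zero]
  | smul c a _ ha => rw [dotProduct_smul, ha, smul_zero]

end LatticePolytope

/-- Integer vectors independent over `ℤ` stay independent over `ℝ`. This serves both to compute the
rank of the orthogonal lattice and to prescribe logarithms on a basis. -/
lemma linearIndependent_toReal {ι : Type*} {L : AddSubgroup (Fin n → ℤ)}
    (b : Module.Basis ι ℤ L) : LinearIndependent ℝ fun i => toReal (b i).1 := by
  let φ : L →ₗ[ℤ] (Fin n → ℤ) :=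
    { toFun := Subtype.val, map_add' := fun _ _ => rfl, map_smul' := fun c x => by simp }
  have hker : LinearMap.ker φ = ⊥ := LinearMap.ker_eq_bot.2 Subtype.val_injective
  have h : LinearIndependent ℤ fun i => (b i).1 := b.linearIndependent.map' φ hker
  have h' : (fun i => toReal (b i).1) = fun i => algebraMap ℤ ℝ ∘ (b i).1 := by
    ext i j
    simp [toReal]
  rw [h']
  exact linearIndependent_algebraMap_comp_iff.2 h

namespace LatticePolytope

variable {P : LatticePolytope n} {m m' : ℕ} {Q Q' : Set (Fin n → ℝ)}

/-- The lattice orthogonal to the normal cone of an `m`-dimensional face has rank `m`. -/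
lemma IsFace.nonempty_basis (hQ : P.IsFace m Q) :
    Nonempty (Module.Basis (Fin m) ℤ (perpLattice (P.normalCone Q))) := by
  set L := perpLattice (P.normalCone Q) with hL
  have : Module.Finite ℤ L := inferInstanceAs (Module.Finite ℤ L.toIntSubmodule)
  have : Module.Free ℤ L := inferInstanceAs (Module.Free ℤ L.toIntSubmodule)
  let b := Module.finBasis ℤ L
  -- Differences of lattice points of `Q` lie in the orthogonal lattice and span the direction of
  -- `Q`, so the rank is `m`.
  have hspan : Submodule.span ℝ (Set.range fun i => toReal (b i).1) = vectorSpan ℝ Q := by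
    apply le_antisymm
    · rw [Submodule.span_le]
      rintro _ ⟨i, rfl⟩
      exact hQ.mem_vectorSpan (b i).2
    · have hmem : ∀ u ∈ L, toReal u ∈ Submodule.span ℝ (Set.range fun i => toReal (b i).1) := by
        intro u hu
        have h := congrArg (fun x : L => toReal x.1) (b.sum_repr ⟨u, hu⟩)
        simp only [AddSubgroup.val_finsetSum, toReal_sum] at h
        rw [← h]
        refine Submodule.sum_mem _ fun i _ => ?_
        have : toReal ((b.repr ⟨u, hu⟩ i • b i : L).1) =
            (b.repr ⟨u, hu⟩ i : ℝ) • toReal (b i).1 := by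
          ext j; simp [toReal]
        rw [this]
        exact Submodule.smul_mem _ _ (Submodule.subset_span ⟨i, rfl⟩)
      obtain ⟨a, ha⟩ := hQ.facePoints_nonempty
      have haQ := hQ.mem_facePoints.1 ha
      have hspanQ : vectorSpan ℝ Q = vectorSpan ℝ
          ((P.facePoints Q).image toReal : Set (Fin n → ℝ)) := by
        conv_lhs => rw [hQ.eq_convexHull, ← direction_affineSpan, affineSpan_convexHull,
          direction_affineSpan]
      have haI : toReal a ∈ ((P.facePoints Q).image toReal : Set (Fin n → ℝ)) :=
        Finset.mem_coe.2 (Finset.mem_image_of_mem _ ha)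
      rw [hspanQ, vectorSpan_eq_span_vsub_set_right ℝ haI, Submodule.span_le]
      rintro _ ⟨y, hy, rfl⟩
      obtain ⟨u, hu, rfl⟩ := Finset.mem_image.1 (Finset.mem_coe.1 hy)
      have := hmem (u - a) ((hQ.sub_mem_perpLattice_iff haQ
        (LatticePolytope.mem_facePoints.1 hu).1).2 (hQ.mem_facePoints.1 hu))
      rwa [toReal_sub] at this
  have hcard := finrank_span_eq_card (linearIndependent_toReal b)
  rw [hspan, hQ.2.2, Fintype.card_fin] at hcard
  exact ⟨b.reindex (finCongr hcard.symm)⟩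

end LatticePolytope

end

/-! ### Strata of the toric functor and their images in the polytope. -/

section

variable {n : ℕ}

/-! ### Semigroup homomorphisms -/

namespace SgHom

variable {S T : AddSubmonoid (Fin n → ℤ)} {A B : Type} [CommMonoid A] [CommMonoid B]

lemma map_zero (f : SgHom S A) : f.1 0 = 1 := f.2.1

lemma apply_congr (f : SgHom S A) {u v : S} (h : u.1 = v.1) : f.1 u = f.1 v :=
  congrArg f.1 (Subtype.ext h)

lemma map_add (f : SgHom S A) (u v : S) : f.1 (u + v) = f.1 u * f.1 v := f.2.2 u v

lemma map_nsmul (f : SgHom S A) (k : ℕ) (u : S) : f.1 (k • u) = f.1 u ^ k := by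
  induction k with
  | zero => rw [zero_nsmul, pow_zero, f.map_zero]
  | succ k ih => rw [succ_nsmul, f.map_add, ih, pow_succ]

lemma map_sum {ι : Type*} (f : SgHom S A) (s : Finset ι) (u : ι → S) :
    f.1 (∑ i ∈ s, u i) = ∏ i ∈ s, f.1 (u i) := by
  classical
  induction s using Finset.induction_on with
  | empty => simp [f.map_zero]
  | insert i s hi ih => rw [Finset.sum_insert hi, Finset.prod_insert hi, f.map_add, ih]

lemma restrict_apply (h : S ≤ T) (f : SgHom T A) (u : S) :
    (f.restrict h).1 u = f.1 ⟨u.1, h u.2⟩ := rfl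

lemma comp_apply (φ : A →* B) (f : SgHom S A) (u : S) : (f.comp φ).1 u = φ (f.1 u) := rfl

/-- The value at an invertible element is invertible. -/
lemma isUnit_of_neg_mem (f : SgHom S A) {u : Fin n → ℤ} (hu : u ∈ S) (hu' : -u ∈ S) :
    IsUnit (f.1 ⟨u, hu⟩) := by
  refine IsUnit.of_mul_eq_one (f.1 ⟨-u, hu'⟩) ?_
  rw [← f.map_add]
  exact (f.apply_congr (add_neg_cancel u)).trans f.map_zero

end SgHom

/-! ### Faces of rational cones cut out by integer vectors -/

variable {σ τ ρ : PointedCone ℝ (Fin n → ℝ)}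

/-- `τ` is the face of `σ` on which the integer vector `u ∈ S^σ` vanishes. -/
structure CutsFace (u : Fin n → ℤ) (τ σ : PointedCone ℝ (Fin n → ℝ)) : Prop where
  mem : u ∈ dualSemigroup σ
  mem_iff : ∀ w, w ∈ τ ↔ w ∈ σ ∧ toReal u ⬝ᵥ w = 0

lemma CutsFace.le {u : Fin n → ℤ} (h : CutsFace u τ σ) : τ ≤ σ := fun w hw => ((h.mem_iff w).1 hw).1

lemma CutsFace.mem_perpLattice {u : Fin n → ℤ} (h : CutsFace u τ σ) : u ∈ perpLattice τ :=
  fun w hw => ((h.mem_iff w).1 hw).2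

lemma CutsFace.isConeFace {u : Fin n → ℤ} (h : CutsFace u τ σ) : IsConeFace τ σ :=
  ⟨toReal u, h.mem, h.mem_iff⟩

lemma CutsFace.inf {u v : Fin n → ℤ} (hu : CutsFace u τ σ) (hv : CutsFace v ρ σ) :
    CutsFace (u + v) (τ ⊓ ρ) σ where
  mem := add_mem hu.mem hv.mem
  mem_iff w := by
    rw [Submodule.mem_inf, hu.mem_iff, hv.mem_iff, toReal_add, add_dotProduct]
    constructor
    · rintro ⟨⟨h, h1⟩, -, h2⟩
      exact ⟨h, by rw [h1, h2, add_zero]⟩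
    · rintro ⟨h, h0⟩
      have h1 := hu.mem w h
      have h2 := hv.mem w h
      exact ⟨⟨h, by linarith⟩, h, by linarith⟩

/-- The face of `σ` on which `u` vanishes. -/
def cutFace (σ : PointedCone ℝ (Fin n → ℝ)) (u : Fin n → ℤ) : PointedCone ℝ (Fin n → ℝ) where
  carrier := {w | w ∈ σ ∧ toReal u ⬝ᵥ w = 0}
  zero_mem' := ⟨zero_mem _, by simp⟩
  add_mem' := fun ⟨ha, ha'⟩ ⟨hb, hb'⟩ =>
    ⟨add_mem ha hb, by rw [dotProduct_add, ha', hb', add_zero]⟩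
  smul_mem' := fun c a ⟨ha, ha'⟩ => ⟨Submodule.smul_mem _ c ha, by
    have h : c • a = (c : ℝ) • a := rfl
    rw [h, dotProduct_smul, ha', smul_zero]⟩

lemma cutsFace_cutFace {u : Fin n → ℤ} (hu : u ∈ dualSemigroup σ) :
    CutsFace u (cutFace σ u) σ := ⟨hu, fun _ => Iff.rfl⟩

/-- A rational polyhedral cone. -/
def IsRational (σ : PointedCone ℝ (Fin n → ℝ)) : Prop :=
  ∃ s : Finset (Fin n → ℤ), σ = PointedCone.hull ℝ (toReal '' (s : Set _))

lemma mem_dualSemigroup_of_generators {s : Finset (Fin n → ℤ)}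
    (hs : σ = PointedCone.hull ℝ (toReal '' (s : Set _))) {u : Fin n → ℤ}
    (h : ∀ v ∈ s, 0 ≤ u ⬝ᵥ v) : u ∈ dualSemigroup σ := by
  intro w hw
  rw [hs] at hw
  induction hw using Submodule.span_induction with
  | mem w hw =>
    obtain ⟨v, hv, rfl⟩ := hw
    rw [toReal_dotProduct_toReal]
    exact_mod_cast h v hv
  | zero => simp
  | add a b _ _ ha hb => rw [dotProduct_add]; exact add_nonneg ha hb
  | smul c a _ ha =>
    have h : c • a = (c : ℝ) • a := rfl
    rw [h, dotProduct_smul]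
    exact mul_nonneg c.2 ha

lemma generator_mem {s : Finset (Fin n → ℤ)}
    (hs : σ = PointedCone.hull ℝ (toReal '' (s : Set _))) {v : Fin n → ℤ} (hv : v ∈ s) :
    toReal v ∈ σ := hs ▸ Submodule.subset_span ⟨v, hv, rfl⟩

lemma dotProduct_generator_nonneg {s : Finset (Fin n → ℤ)}
    (hs : σ = PointedCone.hull ℝ (toReal '' (s : Set _))) {u v : Fin n → ℤ}
    (hu : u ∈ dualSemigroup σ) (hv : v ∈ s) : 0 ≤ u ⬝ᵥ v := by
  have := hu _ (generator_mem hs hv)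
  rw [toReal_dotProduct_toReal] at this
  exact_mod_cast this

lemma exists_add_nsmul_mem_of_generators {s : Finset (Fin n → ℤ)}
    (hs : σ = PointedCone.hull ℝ (toReal '' (s : Set _))) {u u₀ : Fin n → ℤ}
    (hu₀ : u₀ ∈ dualSemigroup σ) (h : ∀ v ∈ s, u₀ ⬝ᵥ v = 0 → 0 ≤ u ⬝ᵥ v) :
    ∃ N : ℕ, u + N • u₀ ∈ dualSemigroup σ := by
  -- By integrality, a positive value of `u₀` on a generator is at least `1`, so this multiple
  -- outweighs any negative value of `u`.
  refine ⟨∑ v ∈ s, (u ⬝ᵥ v).natAbs, mem_dualSemigroup_of_generators hs fun v hv => ?_⟩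
  rw [add_dotProduct, smul_dotProduct, nsmul_eq_mul]
  rcases (dotProduct_generator_nonneg hs hu₀ hv).eq_or_lt with h0 | h0
  · rw [← h0, mul_zero, add_zero]
    exact h v hv h0.symm
  · have h1 : ((u ⬝ᵥ v).natAbs : ℤ) ≤ ((∑ v ∈ s, (u ⬝ᵥ v).natAbs : ℕ) : ℤ) := by
      exact_mod_cast Finset.single_le_sum (f := fun v => (u ⬝ᵥ v).natAbs)
        (fun _ _ => Nat.zero_le _) hv
    have h2 : -(u ⬝ᵥ v) ≤ ((u ⬝ᵥ v).natAbs : ℤ) := by omega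
    nlinarith

/-- Every element of `S^τ` becomes an element of `S^σ` after adding a multiple of `u₀`. -/
lemma CutsFace.exists_add_nsmul_mem (hσ : IsRational σ) {u₀ u : Fin n → ℤ}
    (h : CutsFace u₀ τ σ) (hu : u ∈ dualSemigroup τ) :
    ∃ N : ℕ, u + N • u₀ ∈ dualSemigroup σ := by
  obtain ⟨s, hs⟩ := hσ
  refine exists_add_nsmul_mem_of_generators hs h.mem fun v hv hv0 => ?_
  have := hu (toReal v) ((h.mem_iff _).2 ⟨generator_mem hs hv, by
    rw [toReal_dotProduct_toReal, hv0, Int.cast_zero]⟩)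
  rw [toReal_dotProduct_toReal] at this
  exact_mod_cast this

/-- `S^σ ∩ σ^⊥` is a face of the semigroup `S^σ`. -/
lemma add_mem_perpLattice_iff {u v : Fin n → ℤ} (hu : u ∈ dualSemigroup σ)
    (hv : v ∈ dualSemigroup σ) :
    u + v ∈ perpLattice σ ↔ u ∈ perpLattice σ ∧ v ∈ perpLattice σ := by
  refine ⟨fun h => ?_, fun h => add_mem h.1 h.2⟩
  have key : ∀ w ∈ σ, toReal u ⬝ᵥ w = 0 ∧ toReal v ⬝ᵥ w = 0 := fun w hw => by
    have := h w hw
    rw [toReal_add, add_dotProduct] at this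
    have := hu w hw
    have := hv w hw
    constructor <;> linarith
  exact ⟨fun w hw => (key w hw).1, fun w hw => (key w hw).2⟩

variable {A B : Type} [CommMonoid A] [CommMonoid B]

/-- The elements at which `f` is invertible are the elements of `S^σ` orthogonal to a face. -/
lemma exists_cutsFace_isUnit_iff (hσ : IsRational σ) (f : SgHom (dualSemigroup σ) A) :
    ∃ (τ : PointedCone ℝ (Fin n → ℝ)) (u₀ : Fin n → ℤ) (h : CutsFace u₀ τ σ),
      IsUnit (f.1 ⟨u₀, h.mem⟩) ∧ ∀ u, IsUnit (f.1 u) ↔ u.1 ∈ perpLattice τ := by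
  classical
  obtain ⟨s, hs⟩ := hσ
  -- For each generator, choose an element with invertible value that is nonzero on it, if there is
  -- one. The sum `u₀` of the choices vanishes only on those generators where every element with
  -- invertible value does.
  have hch : ∀ v : Fin n → ℤ, ∃ u : dualSemigroup σ, IsUnit (f.1 u) ∧
      (u.1 ⬝ᵥ v = 0 → ∀ u' : dualSemigroup σ, IsUnit (f.1 u') → u'.1 ⬝ᵥ v = 0) := by
    intro v
    by_cases h : ∃ u : dualSemigroup σ, IsUnit (f.1 u) ∧ u.1 ⬝ᵥ v ≠ 0
    · obtain ⟨u, hu, huv⟩ := h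
      exact ⟨u, hu, fun h0 => absurd h0 huv⟩
    · push Not at h
      exact ⟨0, by rw [f.map_zero]; exact isUnit_one, fun _ => h⟩
  choose c hcu hc using hch
  set u₀ : dualSemigroup σ := ∑ v ∈ s, c v with hu₀
  have hunit : IsUnit (f.1 u₀) := by
    rw [hu₀, f.map_sum]
    exact IsUnit.prod_iff.2 fun v _ => hcu v
  have hval : u₀.1 = ∑ v ∈ s, (c v).1 := by rw [hu₀, AddSubmonoid.coe_finsetSum]
  have hzero : ∀ v ∈ s, u₀.1 ⬝ᵥ v = 0 → (c v).1 ⬝ᵥ v = 0 := by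
    intro v hv h0
    rw [hval, sum_dotProduct, Finset.sum_eq_zero_iff_of_nonneg
      (fun v' _ => dotProduct_generator_nonneg hs (c v').2 hv)] at h0
    exact h0 v hv
  -- Such a `u` is a summand of a multiple of `u₀`. Both being orthogonal to a face and having an
  -- invertible value pass from a sum to its summands.
  have hdiv : ∀ u : dualSemigroup σ, (∀ v ∈ s, u₀.1 ⬝ᵥ v = 0 → u.1 ⬝ᵥ v = 0) →
      ∃ N : ℕ, ∃ u' : dualSemigroup σ, u + u' = N • u₀ := by
    intro u hu
    obtain ⟨N, hN⟩ := exists_add_nsmul_mem_of_generators hs (u := -u.1) u₀.2 (fun v hv h0 => by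
      rw [neg_dotProduct, hu v hv h0, neg_zero])
    refine ⟨N, ⟨_, hN⟩, ?_⟩
    ext1
    simp
  refine ⟨cutFace σ u₀.1, u₀.1, cutsFace_cutFace u₀.2, hunit, fun u => ⟨fun hu => ?_, fun hu => ?_⟩⟩
  · obtain ⟨N, u', hN⟩ := hdiv u fun v hv h0 => hc v (hzero v hv h0) u hu
    have hcut := cutsFace_cutFace (σ := σ) u₀.2
    have hsum : u.1 + u'.1 ∈ perpLattice (cutFace σ u₀.1) := by
      rw [← AddSubmonoid.coe_add, hN]
      exact nsmul_mem hcut.mem_perpLattice N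
    exact ((add_mem_perpLattice_iff (dualSemigroup_anti hcut.le u.2)
      (dualSemigroup_anti hcut.le u'.2)).1 hsum).1
  · obtain ⟨N, u', hN⟩ := hdiv u fun v hv h0 => by
      have := hu (toReal v) ⟨generator_mem hs hv, by
        rw [toReal_dotProduct_toReal, h0, Int.cast_zero]⟩
      rw [toReal_dotProduct_toReal] at this
      exact_mod_cast this
    have h1 : IsUnit (f.1 (u + u')) := by
      rw [hN, f.map_nsmul]
      exact hunit.pow N
    rw [f.map_add] at h1
    exact isUnit_of_mul_isUnit_left h1

/-! ### Extending homomorphisms to the semigroup of a face -/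

section Lift

variable {u₀ : Fin n → ℤ} (h : CutsFace u₀ τ σ)
include h

/-- `S^τ` is the localization of `S^σ` at `u₀`; this identity recovers `g` from its restriction,
because the value at `u₀` is invertible. -/
lemma CutsFace.apply_mul_pow (g : SgHom (dualSemigroup τ) A) {N : ℕ} (u : dualSemigroup τ)
    (hu : u.1 + N • u₀ ∈ dualSemigroup σ) :
    g.1 u * (g.restrict (dualSemigroup_anti h.le)).1 ⟨u₀, h.mem⟩ ^ N =
      (g.restrict (dualSemigroup_anti h.le)).1 ⟨u.1 + N • u₀, hu⟩ := by
  rw [SgHom.restrict_apply, SgHom.restrict_apply, ← g.map_nsmul, ← g.map_add]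
  rfl

lemma CutsFace.isUnit_restrict (g : SgHom (dualSemigroup τ) A) :
    IsUnit ((g.restrict (dualSemigroup_anti h.le)).1 ⟨u₀, h.mem⟩) :=
  g.isUnit_of_neg_mem _ (perpLattice_le (neg_mem h.mem_perpLattice))

lemma CutsFace.restrict_injective (hσ : IsRational σ) {g g' : SgHom (dualSemigroup τ) A}
    (hg : g.restrict (dualSemigroup_anti h.le) = g'.restrict (dualSemigroup_anti h.le)) :
    g = g' := by
  ext u
  obtain ⟨N, hN⟩ := h.exists_add_nsmul_mem hσ u.2
  have h1 := h.apply_mul_pow g u hN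
  rw [hg, ← h.apply_mul_pow g' u hN] at h1
  exact ((h.isUnit_restrict g').pow N).mul_right_cancel h1

/-- The universal property of the localization: the extension is `f (u + N u₀) * f(u₀)^(-N)`, which
by `hval` does not depend on the choice of `N`. -/
lemma CutsFace.exists_restrict_eq (hσ : IsRational σ) (f : SgHom (dualSemigroup σ) A)
    (hf : IsUnit (f.1 ⟨u₀, h.mem⟩)) :
    ∃ g : SgHom (dualSemigroup τ) A, g.restrict (dualSemigroup_anti h.le) = f := by
  obtain ⟨c, hc⟩ := hf
  choose N hN using fun u : dualSemigroup τ => h.exists_add_nsmul_mem hσ u.2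
  have hval : ∀ (u : dualSemigroup τ) (k : ℕ) (hk : u.1 + k • u₀ ∈ dualSemigroup σ),
      f.1 ⟨_, hN u⟩ * ↑(c⁻¹ ^ N u) = f.1 ⟨_, hk⟩ * ↑(c⁻¹ ^ k) := by
    intro u k hk
    have h1 : f.1 ⟨_, hN u⟩ * ↑(c ^ k) = f.1 ⟨_, hk⟩ * ↑(c ^ N u) := by
      rw [Units.val_pow_eq_pow_val, Units.val_pow_eq_pow_val, hc, ← f.map_nsmul, ← f.map_nsmul,
        ← f.map_add, ← f.map_add]
      refine f.apply_congr ?_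
      change u.1 + N u • u₀ + k • u₀ = u.1 + k • u₀ + N u • u₀
      abel
    rw [inv_pow, inv_pow, Units.mul_inv_eq_iff_eq_mul, mul_right_comm, ← h1, mul_assoc,
      Units.mul_inv, mul_one]
  refine ⟨⟨fun u => f.1 ⟨_, hN u⟩ * ↑(c⁻¹ ^ N u), ?_, fun u v => ?_⟩, ?_⟩
  · refine (hval 0 0 (by simp)).trans ?_
    rw [pow_zero, Units.val_one, mul_one]
    exact (f.apply_congr (by simp)).trans f.map_zero
  · have hk : (u + v).1 + (N u + N v) • u₀ ∈ dualSemigroup σ := by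
      have := add_mem (hN u) (hN v)
      convert this using 1
      rw [AddSubmonoid.coe_add, add_smul]
      abel
    change f.1 ⟨_, hN (u + v)⟩ * ↑(c⁻¹ ^ N (u + v)) = _
    rw [hval (u + v) (N u + N v) hk, pow_add, Units.val_mul, mul_mul_mul_comm, ← f.map_add]
    congr 1
    refine f.apply_congr ?_
    change u.1 + v.1 + (N u + N v) • u₀ = u.1 + N u • u₀ + (v.1 + N v • u₀)
    rw [add_smul]
    abel
  · ext u
    rw [SgHom.restrict_apply]
    change f.1 ⟨_, hN ⟨u.1, _⟩⟩ * _ = _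
    rw [hval ⟨u.1, _⟩ 0 (by simp)]
    rw [pow_zero, Units.val_one, mul_one]
    exact f.apply_congr (by simp)

end Lift

/-! ### Charts and strata of the toric functor -/

/-- Inclusions of cones of the fan are faces cut out by integer vectors. -/
def Fan.HasIntegralFaces (F : Fan n) : Prop :=
  ∀ σ ∈ F.cones, ∀ τ ∈ F.cones, τ ≤ σ → ∃ u, CutsFace u τ σ

lemma Fan.inf_mem (F : Fan n) (hσ : σ ∈ F.cones) (hτ : τ ∈ F.cones) : σ ⊓ τ ∈ F.cones :=
  F.face_mem σ hσ _ (F.inter_face σ hσ τ hτ)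

lemma Fan.isRational (F : Fan n) (σ : F.cones) : IsRational σ.1 := F.rational σ.1 σ.2

lemma Fan.chart_restrict (F : Fan n) {σ τ : F.cones} (h : τ.1 ≤ σ.1)
    (g : SgHom (dualSemigroup τ.1) A) :
    F.chart σ (g.restrict (dualSemigroup_anti h)) = F.chart τ g :=
  (Quot.sound ⟨h, rfl⟩ : F.chart τ g = _).symm

lemma Fan.exists_chart (F : Fan n) (x : F.Toric A) : ∃ σ f, x = F.chart σ f := by
  obtain ⟨⟨σ, f⟩, rfl⟩ := Quot.exists_rep x
  exact ⟨σ, f, rfl⟩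

/-- Two points of charts are identified iff they have a common extension to the semigroup of a
smaller cone. -/
lemma Fan.HasIntegralFaces.chart_eq_iff {F : Fan n} (hF : F.HasIntegralFaces) {σ τ : F.cones}
    {f : SgHom (dualSemigroup σ.1) A} {g : SgHom (dualSemigroup τ.1) A} :
    F.chart σ f = F.chart τ g ↔ ∃ (ρ : F.cones) (h₁ : ρ.1 ≤ σ.1) (h₂ : ρ.1 ≤ τ.1)
      (k : SgHom (dualSemigroup ρ.1) A), k.restrict (dualSemigroup_anti h₁) = f ∧
        k.restrict (dualSemigroup_anti h₂) = g := by
  constructor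
  · intro hfg
    have hgen := Quot.eqvGen_exact hfg
    suffices ∀ x y : Σ σ : F.cones, SgHom (dualSemigroup σ.1) A, Relation.EqvGen (F.glue A) x y →
        ∃ (ρ : F.cones) (h₁ : ρ.1 ≤ x.1.1) (h₂ : ρ.1 ≤ y.1.1)
          (k : SgHom (dualSemigroup ρ.1) A), k.restrict (dualSemigroup_anti h₁) = x.2 ∧
            k.restrict (dualSemigroup_anti h₂) = y.2 from this _ _ hgen
    intro x y hxy
    induction hxy with
    | rel x y h =>
      obtain ⟨h, hy⟩ := h
      exact ⟨x.1, le_rfl, h, x.2, rfl, hy.symm⟩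
    | refl x => exact ⟨x.1, le_rfl, le_rfl, x.2, rfl, rfl⟩
    | symm x y _ ih =>
      obtain ⟨ρ, h₁, h₂, k, hk₁, hk₂⟩ := ih
      exact ⟨ρ, h₂, h₁, k, hk₂, hk₁⟩
    | trans x y z _ _ ih₁ ih₂ =>
      obtain ⟨ρ₁, h₁, h₂, k, hk₁, hk₂⟩ := ih₁
      obtain ⟨ρ₂, h₃, h₄, l, hl₁, hl₂⟩ := ih₂
      obtain ⟨u, hu⟩ := hF y.1.1 y.1.2 ρ₁.1 ρ₁.2 h₂
      obtain ⟨v, hv⟩ := hF y.1.1 y.1.2 ρ₂.1 ρ₂.2 h₃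
      -- The middle point is invertible at the vectors cutting out both faces, so it extends to
      -- their intersection; uniqueness of extensions then gives `k` and `l` back.
      have hunit : IsUnit (y.2.1 ⟨u + v, (hu.inf hv).mem⟩) := by
        have : (⟨u + v, (hu.inf hv).mem⟩ : dualSemigroup y.1.1) =
          ⟨u, hu.mem⟩ + ⟨v, hv.mem⟩ := rfl
        rw [this, y.2.map_add]
        refine IsUnit.mul ?_ ?_
        · rw [← hk₂]
          exact hu.isUnit_restrict k
        · rw [← hl₁]
          exact hv.isUnit_restrict l
      obtain ⟨p, hp⟩ := (hu.inf hv).exists_restrict_eq (F.isRational y.1) y.2 hunit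
      refine ⟨⟨ρ₁.1 ⊓ ρ₂.1, F.inf_mem ρ₁.2 ρ₂.2⟩, inf_le_left.trans h₁, inf_le_right.trans h₄, p,
        ?_, ?_⟩
      · have : p.restrict (dualSemigroup_anti inf_le_left) = k :=
          hu.restrict_injective (F.isRational y.1) (by rw [hk₂, ← hp]; rfl)
        rw [← hk₁, ← this]
        rfl
      · have : p.restrict (dualSemigroup_anti inf_le_right) = l :=
          hv.restrict_injective (F.isRational y.1) (by rw [hl₁, ← hp]; rfl)
        rw [← hl₂, ← this]
        rfl
  · rintro ⟨ρ, h₁, h₂, k, rfl, rfl⟩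
    rw [F.chart_restrict h₁, F.chart_restrict h₂]

lemma Fan.HasIntegralFaces.chart_injective {F : Fan n} (hF : F.HasIntegralFaces) (σ : F.cones) :
    Function.Injective (F.chart (A := A) σ) := by
  intro f g h
  obtain ⟨ρ, h₁, h₂, k, rfl, rfl⟩ := hF.chart_eq_iff.1 h
  rfl

/-- The stratum of `F(A)` of a cone `σ`: the points `f` of the chart of `σ` that are invertible
exactly on `σ^⊥`. -/
def Fan.stratum (F : Fan n) (A : Type) [CommMonoid A] (σ : F.cones) : Set (F.Toric A) :=
  {x | ∃ f : SgHom (dualSemigroup σ.1) A,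
    (∀ u, IsUnit (f.1 u) ↔ u.1 ∈ perpLattice σ.1) ∧ x = F.chart σ f}

/-- The point of a chart lies in the stratum of the face on whose orthogonal space it is
invertible. -/
lemma Fan.exists_chart_mem_stratum (F : Fan n) (σ : F.cones) (f : SgHom (dualSemigroup σ.1) A) :
    ∃ τ : F.cones, τ.1 ≤ σ.1 ∧ F.chart σ f ∈ F.stratum A τ ∧
      ∀ u, IsUnit (f.1 u) ↔ u.1 ∈ perpLattice τ.1 := by
  obtain ⟨τ, u₀, h, hu₀, hiff⟩ := exists_cutsFace_isUnit_iff (F.isRational σ) f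
  obtain ⟨g, hg⟩ := h.exists_restrict_eq (F.isRational σ) f hu₀
  have hτ := F.face_mem σ.1 σ.2 τ h.isConeFace
  refine ⟨⟨τ, hτ⟩, h.le, ⟨g, fun u => ?_, ?_⟩, hiff⟩
  · obtain ⟨N, hN⟩ := h.exists_add_nsmul_mem (F.isRational σ) u.2
    have h1 := h.apply_mul_pow g u hN
    have h2 : IsUnit (g.1 u) ↔ IsUnit (f.1 ⟨_, hN⟩) := by
      rw [← hg, ← h1, IsUnit.mul_iff]
      exact ⟨fun h3 => ⟨h3, (h.isUnit_restrict g).pow N⟩, fun h3 => h3.1⟩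
    rw [h2, hiff]
    exact AddSubgroup.add_mem_cancel_right _ (nsmul_mem h.mem_perpLattice N)
  · rw [← hg]
    exact F.chart_restrict (σ := σ) (τ := ⟨τ, hτ⟩) h.le g

lemma Fan.exists_mem_stratum (F : Fan n) (x : F.Toric A) : ∃ τ : F.cones, x ∈ F.stratum A τ := by
  obtain ⟨σ, f, rfl⟩ := F.exists_chart x
  obtain ⟨τ, -, h, -⟩ := F.exists_chart_mem_stratum σ f
  exact ⟨τ, h⟩

/-- A common extension to `ρ` makes each representative invertible at the vector cutting out `ρ`.
That vector is then orthogonal to the whole cone, so `ρ` equals both cones. -/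
lemma Fan.HasIntegralFaces.eq_of_mem_stratum {F : Fan n} (hF : F.HasIntegralFaces)
    {x : F.Toric A} {σ τ : F.cones} (hσ : x ∈ F.stratum A σ) (hτ : x ∈ F.stratum A τ) : σ = τ := by
  obtain ⟨f, hf, rfl⟩ := hσ
  obtain ⟨g, hg, hfg⟩ := hτ
  obtain ⟨ρ, h₁, h₂, k, hk₁, hk₂⟩ := hF.chart_eq_iff.1 hfg
  have key : ∀ (σ : F.cones) (f : SgHom (dualSemigroup σ.1) A) (h : ρ.1 ≤ σ.1),
      (∀ u, IsUnit (f.1 u) ↔ u.1 ∈ perpLattice σ.1) →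
      k.restrict (dualSemigroup_anti h) = f → ρ = σ := by
    intro σ f h hf hk
    obtain ⟨u, hu⟩ := hF σ.1 σ.2 ρ.1 ρ.2 h
    have := hu.isUnit_restrict k
    rw [hk, hf] at this
    exact Subtype.ext (le_antisymm h fun w hw => (hu.mem_iff w).2 ⟨hw, this w hw⟩)
  exact (key σ f h₁ hf hk₁).symm.trans (key τ g h₂ hg hk₂)

lemma Fan.map_mem_stratum (F : Fan n) {φ : A →* B} (hφ : ∀ a, IsUnit (φ a) ↔ IsUnit a)
    {x : F.Toric A} {σ : F.cones} (hx : x ∈ F.stratum A σ) : F.map φ x ∈ F.stratum B σ := by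
  obtain ⟨f, hf, rfl⟩ := hx
  exact ⟨f.comp φ, fun u => (hφ _).trans (hf u), rfl⟩

lemma Fan.HasIntegralFaces.map_mem_stratum_iff {F : Fan n} (hF : F.HasIntegralFaces) {φ : A →* B}
    (hφ : ∀ a, IsUnit (φ a) ↔ IsUnit a) {x : F.Toric A} {σ : F.cones} :
    F.map φ x ∈ F.stratum B σ ↔ x ∈ F.stratum A σ := by
  refine ⟨fun h => ?_, F.map_mem_stratum hφ⟩
  obtain ⟨τ, hτ⟩ := F.exists_mem_stratum x
  exact hF.eq_of_mem_stratum h (F.map_mem_stratum hφ hτ) ▸ hτ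

/-- The homomorphism on `S^σ` that extends a homomorphism on `σ^⊥` by an absorbing element. -/
def SgHom.ofPerp {z : A} (hz : ∀ a, z * a = z) (φ : Multiplicative (perpLattice σ) →* A) :
    SgHom (dualSemigroup σ) A := by
  classical
  exact ⟨fun u => if h : u.1 ∈ perpLattice σ then φ (.ofAdd ⟨u.1, h⟩) else z, by
    beta_reduce
    rw [dif_pos (show ((0 : dualSemigroup σ) : Fin n → ℤ) ∈ perpLattice σ from zero_mem _)]
    exact map_one φ, fun u v => by
    beta_reduce
    have huv := add_mem_perpLattice_iff u.2 v.2
    rw [← AddSubmonoid.coe_add] at huv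
    by_cases hu : u.1 ∈ perpLattice σ
    · by_cases hv : v.1 ∈ perpLattice σ
      · rw [dif_pos hu, dif_pos hv, dif_pos (huv.2 ⟨hu, hv⟩), ← map_mul]
        rfl
      · rw [dif_pos hu, dif_neg hv, dif_neg (fun h => hv (huv.1 h).2), mul_comm, hz]
    · rw [dif_neg hu, dif_neg (fun h => hu (huv.1 h).1), hz]⟩

lemma SgHom.ofPerp_of_mem {z : A} (hz : ∀ a, z * a = z) (φ : Multiplicative (perpLattice σ) →* A)
    {u : dualSemigroup σ} (hu : u.1 ∈ perpLattice σ) :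
    (SgHom.ofPerp hz φ).1 u = φ (.ofAdd ⟨u.1, hu⟩) := dif_pos hu

lemma SgHom.ofPerp_of_notMem {z : A} (hz : ∀ a, z * a = z)
    (φ : Multiplicative (perpLattice σ) →* A)
    {u : dualSemigroup σ} (hu : u.1 ∉ perpLattice σ) : (SgHom.ofPerp hz φ).1 u = z := dif_neg hu

lemma SgHom.isUnit_ofPerp_iff {z : A} (hz : ∀ a, z * a = z) (hz1 : ¬ IsUnit z)
    (φ : Multiplicative (perpLattice σ) →* A) (u : dualSemigroup σ) :
    IsUnit ((SgHom.ofPerp hz φ).1 u) ↔ u.1 ∈ perpLattice σ := by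
  by_cases hu : u.1 ∈ perpLattice σ
  · rw [SgHom.ofPerp_of_mem hz φ hu]
    exact iff_of_true ((Group.isUnit _).map φ) hu
  · rw [SgHom.ofPerp_of_notMem hz φ hu]
    exact iff_of_false hz1 hu

lemma Fan.stratum_nonempty (F : Fan n) {z : A} (hz : ∀ a, z * a = z) (hz1 : ¬ IsUnit z)
    (σ : F.cones) : (F.stratum A σ).Nonempty :=
  ⟨_, SgHom.ofPerp hz 1, SgHom.isUnit_ofPerp_iff hz hz1 1, rfl⟩

/-! ### Strata and faces of the polytope -/

section NormalFan

variable {F : Fan n} {P : LatticePolytope n} (hF : F.IsNormalFan P) {m m' : ℕ}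
  {Q Q' : Set (Fin n → ℝ)}

include hF in
lemma Fan.IsNormalFan.mem_cones (hQ : P.IsFace m Q) : P.normalCone Q ∈ F.cones := by
  rw [show F.cones = _ from hF]
  exact ⟨m, Q, hQ, rfl⟩

include hF in
lemma Fan.IsNormalFan.exists_face (σ : F.cones) :
    ∃ m Q, P.IsFace m Q ∧ σ.1 = P.normalCone Q := by
  obtain ⟨σ, hσ⟩ := σ
  rwa [show F.cones = _ from hF] at hσ

-- For `Q ⊆ Q'` and a lattice point `a` of `Q`, the sum of `v - a` over the lattice points `v` of
-- `Q'` cuts the normal cone of `Q'` out of that of `Q`. The fan axioms alone give only real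
-- supporting vectors.
include hF in
lemma Fan.IsNormalFan.hasIntegralFaces : F.HasIntegralFaces := by
  intro σ hσ τ hτ hle
  obtain ⟨m, Q, hQ, rfl⟩ := hF.exists_face ⟨σ, hσ⟩
  obtain ⟨m', Q', hQ', rfl⟩ := hF.exists_face ⟨τ, hτ⟩
  have hsub := (hQ.normalCone_le_iff hQ').1 hle
  obtain ⟨a, ha⟩ := hQ.facePoints_nonempty
  have haQ := hQ.mem_facePoints.1 ha
  have hnonneg : ∀ w ∈ P.normalCone Q, ∀ v ∈ P.facePoints Q', 0 ≤ toReal (v - a) ⬝ᵥ w := by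
    intro w hw v hv
    rw [toReal_sub, sub_dotProduct, sub_nonneg]
    exact hw _ haQ _ (hQ'.subset (hQ'.mem_facePoints.1 hv))
  refine ⟨∑ v ∈ P.facePoints Q', (v - a), fun w hw => ?_, fun w => ⟨fun hw => ⟨hle hw, ?_⟩, ?_⟩⟩
  · rw [toReal_sum, sum_dotProduct]
    exact Finset.sum_nonneg (hnonneg w hw)
  · rw [toReal_sum, sum_dotProduct]
    refine Finset.sum_eq_zero fun v hv => ?_
    rw [toReal_sub, sub_dotProduct,
      hQ'.dotProduct_eq hw (hQ'.mem_facePoints.1 hv) (hsub haQ), sub_self]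
  · rintro ⟨hw, h0⟩
    rw [toReal_sum, sum_dotProduct, Finset.sum_eq_zero_iff_of_nonneg (hnonneg w hw)] at h0
    refine hQ'.mem_normalCone_of_facePoints fun u hu v hv => ?_
    have := h0 u hu
    rw [toReal_sub, sub_dotProduct, sub_eq_zero] at this
    rw [this]
    exact hw _ haQ v hv

lemma Fan.toPolytope_chart (σ : F.cones) (f : SgHom (dualSemigroup σ.1) ℝ≥0) :
    F.toPolytope P hF (F.chart σ f) = P.average (P.exists_isMinAt hF σ).choose f := rfl

/-- The identification of `Delzant(F)` with `P` sends the stratum of a face to its relative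
interior. -/
lemma Fan.toPolytope_mem_intrinsicInterior (hQ : P.IsFace m Q) {y : F.Delzant}
    (hy : y ∈ F.stratum ℝ≥0 ⟨P.normalCone Q, hF.mem_cones hQ⟩) :
    F.toPolytope P hF y ∈ intrinsicInterior ℝ Q := by
  classical
  obtain ⟨f, hf, rfl⟩ := hy
  rw [Fan.toPolytope_chart]
  set a := (P.exists_isMinAt hF ⟨P.normalCone Q, hF.mem_cones hQ⟩).choose
  have ha : P.IsMinAt (P.normalCone Q) a :=
    (P.exists_isMinAt hF ⟨P.normalCone Q, hF.mem_cones hQ⟩).choose_spec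
  have haQ := hQ.isMinAt_iff.1 ha
  have hval : ∀ u ∈ P.points, 0 ≤ f.val (u - a) ∧ (f.val (u - a) ≠ 0 ↔ toReal u ∈ Q) := by
    intro u hu
    have hmem := ha.sub_mem hu
    rw [SgHom.val, dif_pos hmem]
    refine ⟨NNReal.coe_nonneg _, ?_⟩
    rw [NNReal.coe_ne_zero, ← isUnit_iff_ne_zero, hf, hQ.sub_mem_perpLattice_iff haQ hu]
  have hsub : P.facePoints Q ⊆ P.points := Finset.filter_subset _ _
  have hzero : ∀ u ∈ P.points, u ∉ P.facePoints Q → f.val (u - a) = 0 := by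
    intro u hu hn
    by_contra h0
    exact hn (hQ.mem_facePoints.2 ((hval u hu).2.1 h0))
  have hpos : ∀ u ∈ P.facePoints Q, 0 < f.val (u - a) := fun u hu =>
    lt_of_le_of_ne (hval u (hsub hu)).1
      ((hval u (hsub hu)).2.2 (hQ.mem_facePoints.1 hu)).symm
  set Z := ∑ u ∈ P.facePoints Q, f.val (u - a) with hZ
  have hZpos : 0 < Z := Finset.sum_pos hpos hQ.facePoints_nonempty
  have haver : P.average a f = ∑ u ∈ P.facePoints Q, (Z⁻¹ * f.val (u - a)) • toReal u := by
    rw [LatticePolytope.average, ← Finset.sum_subset hsub hzero,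
      ← Finset.sum_subset hsub (fun u hu hn => by rw [hzero u hu hn, zero_smul]),
      Finset.smul_sum]
    simp only [smul_smul]
    rfl
  -- `sum_mem_intrinsicInterior` takes weights on real vectors, so they are transported along the
  -- injection `toReal`.
  obtain ⟨c, hc⟩ : ∃ c : (Fin n → ℝ) → ℝ, ∀ u, c (toReal u) = Z⁻¹ * f.val (u - a) :=
    ⟨fun x => Z⁻¹ * f.val (Function.invFun toReal x - a), fun u => by
      beta_reduce
      rw [Function.leftInverse_invFun toReal_injective u]⟩
  have key := sum_mem_intrinsicInterior ((P.facePoints Q).image toReal) c ?_ ?_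
  · rw [← hQ.eq_convexHull, Finset.sum_image toReal_injective.injOn] at key
    simpa only [haver, hc] using key
  · intro x hx
    obtain ⟨u, hu, rfl⟩ := Finset.mem_image.1 hx
    rw [hc]
    exact mul_pos (inv_pos.2 hZpos) (hpos u hu)
  · rw [Finset.sum_image toReal_injective.injOn]
    simp only [hc]
    rw [← Finset.mul_sum, ← hZ, inv_mul_cancel₀ hZpos.ne']

/-- The converse is formal: `y` lies in some stratum, and relative interiors of distinct faces are
disjoint. -/
lemma Fan.toPolytope_mem_intrinsicInterior_iff (hQ : P.IsFace m Q) {y : F.Delzant} :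
    F.toPolytope P hF y ∈ intrinsicInterior ℝ Q ↔
      y ∈ F.stratum ℝ≥0 ⟨P.normalCone Q, hF.mem_cones hQ⟩ := by
  refine ⟨fun h => ?_, F.toPolytope_mem_intrinsicInterior hF hQ⟩
  obtain ⟨⟨τ, hτ⟩, hy⟩ := F.exists_mem_stratum y
  obtain ⟨m', Q', hQ', rfl⟩ := hF.exists_face ⟨τ, hτ⟩
  have h' := F.toPolytope_mem_intrinsicInterior hF hQ' hy
  obtain rfl := hQ.eq_of_mem_intrinsicInterior hQ' h h'
  exact hy

lemma Fan.toPolytope_mem_iff (hQ : P.IsFace m Q) {y : F.Delzant} {τ : F.cones}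
    (hy : y ∈ F.stratum ℝ≥0 τ) : F.toPolytope P hF y ∈ Q ↔ P.normalCone Q ≤ τ.1 := by
  obtain ⟨τ, hτ⟩ := τ
  obtain ⟨m', Q', hQ', rfl⟩ := hF.exists_face ⟨τ, hτ⟩
  have h' := F.toPolytope_mem_intrinsicInterior hF hQ' hy
  rw [hQ'.normalCone_le_iff hQ]
  exact ⟨fun h => hQ'.subset_of_mem_intrinsicInterior hQ h' h,
    fun h => h (intrinsicInterior_subset h')⟩

end NormalFan

end

/-! ### Topology of the charts, and coordinates on strata and fibers. -/

section

variable {n : ℕ} {σ τ ρ : PointedCone ℝ (Fin n → ℝ)} {A B : Type} [CommMonoid A] [CommMonoid B]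

/-! ### The charts are open embeddings -/

/-- The invertible elements form an open set, on which the inverse is continuous. -/
structure HasOpenUnits (A : Type) [CommMonoid A] [TopologicalSpace A] : Prop where
  isOpen : IsOpen {a : A | IsUnit a}
  exists_inv : ∃ ι : A → A, ContinuousOn ι {a | IsUnit a} ∧ ∀ a, IsUnit a → a * ι a = 1

section Topology

variable [TopologicalSpace A]

lemma SgHom.continuous_apply {S : AddSubmonoid (Fin n → ℤ)} (u : S) :
    Continuous fun f : SgHom S A => f.1 u :=
  (_root_.continuous_apply u).comp continuous_subtype_val

lemma SgHom.continuous_restrict {S T : AddSubmonoid (Fin n → ℤ)} (h : S ≤ T) :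
    Continuous (SgHom.restrict (A := A) h) :=
  Continuous.subtype_mk (continuous_pi fun _ => SgHom.continuous_apply _) _

/-- Restriction from the semigroup of a face is an open map. -/
lemma CutsFace.isOpenMap_restrict [ContinuousMul A] (hA : HasOpenUnits A) (hσ : IsRational σ)
    {u₀ : Fin n → ℤ} (h : CutsFace u₀ τ σ) :
    IsOpenMap (SgHom.restrict (A := A) (dualSemigroup_anti h.le)) := by
  intro U hU
  obtain ⟨ι, hι, hinv⟩ := hA.exists_inv
  obtain ⟨V, hV, rfl⟩ := isOpen_induced_iff.1 hU
  choose N hN using fun u : dualSemigroup τ => h.exists_add_nsmul_mem hσ u.2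
  -- The extension formula as a function of `f`, continuous where `f(u₀)` is invertible; it inverts
  -- restriction there.
  let E : SgHom (dualSemigroup σ) A → dualSemigroup τ → A :=
    fun f u => f.1 ⟨_, hN u⟩ * ι (f.1 ⟨u₀, h.mem⟩) ^ N u
  let D : Set (SgHom (dualSemigroup σ) A) := {f | IsUnit (f.1 ⟨u₀, h.mem⟩)}
  have hD : IsOpen D := hA.isOpen.preimage (SgHom.continuous_apply _)
  have hE : ContinuousOn E D := by
    refine continuousOn_pi.2 fun u => ?_
    refine (SgHom.continuous_apply _).continuousOn.mul (ContinuousOn.pow ?_ _)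
    exact hι.comp (SgHom.continuous_apply _).continuousOn fun f hf => hf
  have hEr : ∀ g : SgHom (dualSemigroup τ) A,
      E (g.restrict (dualSemigroup_anti h.le)) = g.1 := by
    intro g
    ext u
    change _ * _ = _
    rw [← h.apply_mul_pow g u (hN u), mul_assoc, ← mul_pow, hinv _ (h.isUnit_restrict g), one_pow,
      mul_one]
  convert hE.isOpen_inter_preimage hD hV using 1
  ext f
  constructor
  · rintro ⟨g, hg, rfl⟩
    exact ⟨h.isUnit_restrict g, by rw [Set.mem_preimage, hEr]; exact hg⟩
  · rintro ⟨hf, hfV⟩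
    obtain ⟨g, rfl⟩ := h.exists_restrict_eq hσ f hf
    rw [Set.mem_preimage, hEr] at hfV
    exact ⟨g, hfV, rfl⟩

lemma Fan.continuous_chart (F : Fan n) (σ : F.cones) : Continuous (F.chart (A := A) σ) :=
  continuous_quot_mk.comp (continuous_sigmaMk (σ := fun σ : F.cones => SgHom (dualSemigroup σ.1) A))

lemma Fan.isOpen_iff (F : Fan n) {U : Set (F.Toric A)} :
    IsOpen U ↔ ∀ σ : F.cones, IsOpen (F.chart σ ⁻¹' U) :=
  isOpen_coinduced.trans isOpen_sigma_iff

lemma Fan.isClosed_iff (F : Fan n) {U : Set (F.Toric A)} :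
    IsClosed U ↔ ∀ σ : F.cones, IsClosed (F.chart σ ⁻¹' U) := by
  simp only [← isOpen_compl_iff, F.isOpen_iff, Set.preimage_compl]

/-- Two charts overlap in the chart of the intersection of their cones. Seen in the other chart, an
open set is therefore the image of an open set under restriction from a face, which is an open map.
-/
lemma Fan.HasIntegralFaces.isOpenEmbedding_chart [ContinuousMul A] {F : Fan n}
    (hF : F.HasIntegralFaces) (hA : HasOpenUnits A) (σ : F.cones) :
    Topology.IsOpenEmbedding (F.chart (A := A) σ) := by
  refine .of_continuous_injective_isOpenMap (F.continuous_chart σ) (hF.chart_injective σ) ?_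
  intro U hU
  rw [F.isOpen_iff]
  intro τ
  have hρ := F.inf_mem σ.2 τ.2
  obtain ⟨u, hu⟩ := hF τ.1 τ.2 _ hρ inf_le_right
  have hop := hu.isOpenMap_restrict hA (F.isRational τ) _
    (hU.preimage (SgHom.continuous_restrict (dualSemigroup_anti (inf_le_left : σ.1 ⊓ τ.1 ≤ σ.1))))
  convert hop using 1
  ext g
  constructor
  · rintro ⟨f, hf, hfg⟩
    obtain ⟨ρ, h₁, h₂, k, rfl, rfl⟩ := hF.chart_eq_iff.1 hfg
    exact ⟨k.restrict (dualSemigroup_anti (le_inf h₁ h₂)), hf, rfl⟩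
  · rintro ⟨k, hk, rfl⟩
    refine ⟨_, hk, ?_⟩
    rw [F.chart_restrict (σ := σ) (τ := ⟨_, hρ⟩) inf_le_left,
      F.chart_restrict (σ := τ) (τ := ⟨_, hρ⟩) inf_le_right]

end Topology

/-! ### Invertible elements of `ℂ_ℚ` -/

lemma CQ.apply_eq_zero_iff (z : CQ) (k : ℕ+) : z.1 k = 0 ↔ z.1 1 = 0 := by
  rw [← z.2 1 k, one_mul, pow_eq_zero_iff k.ne_zero]

/-- The element `0` of `ℂ_ℚ`. -/
def CQ.zero : CQ := ⟨0, fun _ k => zero_pow k.ne_zero⟩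

lemma CQ.zero_mul (z : CQ) : CQ.zero * z = CQ.zero := by
  ext k
  exact MulZeroClass.zero_mul _

/-- The levelwise inverse. -/
def CQ.inv (z : CQ) : CQ := ⟨fun k => (z.1 k)⁻¹, fun m k => by rw [inv_pow, z.2]⟩

lemma CQ.mul_inv {z : CQ} (hz : z.1 1 ≠ 0) : z * z.inv = 1 := by
  ext k
  exact mul_inv_cancel₀ (mt (CQ.apply_eq_zero_iff z k).1 hz)

lemma CQ.isUnit_iff {z : CQ} : IsUnit z ↔ z.1 1 ≠ 0 :=
  ⟨fun h => (h.map (powLimit.proj₁ ℂ)).ne_zero, fun h => IsUnit.of_mul_eq_one _ (CQ.mul_inv h)⟩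

lemma CQ.not_isUnit_zero : ¬ IsUnit CQ.zero := fun h => CQ.isUnit_iff.1 h rfl

lemma CQ.eq_zero_of_not_isUnit {z : CQ} (hz : ¬ IsUnit z) : z = CQ.zero := by
  rw [CQ.isUnit_iff, not_not] at hz
  ext k
  exact (CQ.apply_eq_zero_iff z k).2 hz

lemma CQ.isUnit_proj₁_iff (z : CQ) : IsUnit (powLimit.proj₁ ℂ z) ↔ IsUnit z := by
  rw [CQ.isUnit_iff, isUnit_iff_ne_zero]
  rfl

lemma CQ.isUnit_abs_iff (z : CQ) : IsUnit (CQ.abs z) ↔ IsUnit z := by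
  rw [CQ.isUnit_iff, isUnit_iff_ne_zero]
  exact nnnorm_ne_zero_iff

lemma CQ.hasOpenUnits : HasOpenUnits CQ where
  isOpen := by
    simp only [CQ.isUnit_iff]
    exact isOpen_ne.preimage ((continuous_apply 1).comp continuous_subtype_val)
  exists_inv := by
    refine ⟨CQ.inv, ?_, fun z hz => CQ.mul_inv (CQ.isUnit_iff.1 hz)⟩
    rw [Topology.IsInducing.subtypeVal.continuousOn_iff, continuousOn_pi]
    intro k
    refine ContinuousOn.inv₀ ((continuous_apply k).comp continuous_subtype_val).continuousOn ?_
    intro z hz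
    exact mt (CQ.apply_eq_zero_iff z k).1 (CQ.isUnit_iff.1 hz)

lemma CQStar.exists_incl_eq {z : CQ} (hz : IsUnit z) : ∃ w : CQStar, CQStar.incl w = z := by
  have h : ∀ k, z.1 k ≠ 0 := fun k => mt (CQ.apply_eq_zero_iff z k).1 (CQ.isUnit_iff.1 hz)
  refine ⟨⟨fun k => Units.mk0 (z.1 k) (h k), fun m k => ?_⟩, ?_⟩
  · ext
    exact z.2 m k
  · ext k
    rfl

lemma CQStar.isEmbedding_incl : Topology.IsEmbedding CQStar.incl := by
  have h1 : Topology.IsEmbedding (fun z : CQStar => Pi.map (fun _ => Units.val) z.1 : CQStar → ℕ+ → ℂ) :=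
    (Topology.IsEmbedding.piMap fun _ => Units.isEmbedding_val₀).comp .subtypeVal
  refine .of_comp ?_ continuous_subtype_val h1
  exact Continuous.subtype_mk h1.continuous _

lemma powLimit.continuous_map {G H : Type} [CommMonoid G] [CommMonoid H] [TopologicalSpace G]
    [TopologicalSpace H] {φ : G →* H} (hφ : Continuous φ) : Continuous (powLimit.map φ) :=
  Continuous.subtype_mk (continuous_pi fun k =>
    hφ.comp ((continuous_apply k).comp continuous_subtype_val)) _

/-! ### Parametrization of the strata -/

/-- A homomorphism on `S^σ` whose invertible values are those on `σ^⊥` is determined by its values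
on a basis of `σ^⊥`. -/
lemma SgHom.ext_of_basis {ι : Type*} (b : Module.Basis ι ℤ (perpLattice σ)) {z : A}
    (hz : ∀ a : A, ¬ IsUnit a → a = z) {f g : SgHom (dualSemigroup σ) A}
    (hf : ∀ u, IsUnit (f.1 u) ↔ u.1 ∈ perpLattice σ)
    (hg : ∀ u, IsUnit (g.1 u) ↔ u.1 ∈ perpLattice σ)
    (hfg : ∀ i, f.1 ⟨(b i).1, perpLattice_le (b i).2⟩ = g.1 ⟨(b i).1, perpLattice_le (b i).2⟩) :
    f = g := by
  -- On `σ^⊥` the values are units; written additively, `f` becomes a `ℤ`-linear map there,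
  -- determined on a basis.
  let r : SgHom (dualSemigroup σ) A → (perpLattice σ →+ Additive Aˣ) := fun f =>
    MonoidHom.toAdditiveRight <| MonoidHom.toHomUnits
      { toFun := fun u : Multiplicative (perpLattice σ) => f.1 ⟨u.toAdd.1, perpLattice_le u.toAdd.2⟩
        map_one' := f.map_zero
        map_mul' := fun u v => f.map_add ⟨u.toAdd.1, _⟩ ⟨v.toAdd.1, _⟩ }
  have hlin : (r f).toIntLinearMap = (r g).toIntLinearMap := by
    refine b.ext fun i => ?_
    apply Additive.toMul.injective
    ext
    exact hfg i
  ext u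
  by_cases hu : u.1 ∈ perpLattice σ
  · have h := congrArg (fun a : Additive Aˣ => (a.toMul : A)) (LinearMap.congr_fun hlin ⟨u.1, hu⟩)
    exact h
  · rw [hz _ (mt (hf u).1 hu), hz _ (mt (hg u).1 hu)]

section Character

variable {m : ℕ} (b : Module.Basis (Fin m) ℤ (perpLattice σ))

/-- The character of `σ^⊥` with given values on a basis. -/
def CQStar.character (g : Fin m → CQStar) : Multiplicative (perpLattice σ) →* CQStar where
  toFun u := ⟨fun k => ∏ i, (g i).1 k ^ (b.repr u.toAdd i), fun l k => by
    rw [← Finset.prod_pow]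
    refine Finset.prod_congr rfl fun i _ => ?_
    rw [← (g i).2 l k, ← zpow_natCast, zpow_comm, zpow_natCast]⟩
  map_one' := by
    ext k
    simp
  map_mul' u v := by
    apply Subtype.ext
    funext k
    change ∏ i, (g i).1 k ^ (b.repr (u.toAdd + v.toAdd) i) =
      (∏ i, (g i).1 k ^ (b.repr u.toAdd i)) * ∏ i, (g i).1 k ^ (b.repr v.toAdd i)
    rw [← Finset.prod_mul_distrib]
    refine Finset.prod_congr rfl fun i _ => ?_
    rw [_root_.map_add, Finsupp.add_apply, zpow_add]

lemma CQStar.character_basis (g : Fin m → CQStar) (i : Fin m) :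
    CQStar.character b g (.ofAdd (b i)) = g i := by
  apply Subtype.ext
  funext k
  change ∏ j, (g j).1 k ^ (b.repr (b i) j) = (g i).1 k
  rw [b.repr_self, Finset.prod_eq_single i]
  · simp
  · intro j _ hj
    rw [Finsupp.single_eq_of_ne hj, zpow_zero]
  · simp

/-- The homomorphism on `S^σ` with given invertible values on a basis of `σ^⊥` and `0` outside
`σ^⊥`. -/
def CQStar.orbitHom (g : Fin m → CQStar) : SgHom (dualSemigroup σ) CQ :=
  SgHom.ofPerp CQ.zero_mul (CQStar.incl.comp (CQStar.character b g))

lemma CQStar.isUnit_orbitHom_iff (g : Fin m → CQStar) (u : dualSemigroup σ) :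
    IsUnit ((CQStar.orbitHom b g).1 u) ↔ u.1 ∈ perpLattice σ :=
  SgHom.isUnit_ofPerp_iff _ CQ.not_isUnit_zero _ u

lemma CQStar.orbitHom_basis (g : Fin m → CQStar) (i : Fin m) :
    (CQStar.orbitHom b g).1 ⟨(b i).1, perpLattice_le (b i).2⟩ = CQStar.incl (g i) := by
  have hu : ((⟨(b i).1, perpLattice_le (b i).2⟩ : dualSemigroup σ) : Fin n → ℤ) ∈ perpLattice σ :=
    (b i).2
  rw [CQStar.orbitHom, SgHom.ofPerp_of_mem _ _ hu, MonoidHom.comp_apply]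
  exact congrArg CQStar.incl (CQStar.character_basis b g i)

/-- Evaluation on the basis is continuous, and after `orbitHom` it becomes the embedding of
`(ℂ*_ℚ)^m` in `(ℂ_ℚ)^m`. Continuity of `orbitHom` itself is that of Laurent monomials and of
constants. -/
lemma CQStar.isEmbedding_orbitHom : Topology.IsEmbedding (CQStar.orbitHom b) := by
  have h1 : Topology.IsEmbedding (Pi.map (fun _ => CQStar.incl) : (Fin m → CQStar) → (Fin m → CQ)) :=
    .piMap fun _ => CQStar.isEmbedding_incl
  have h2 : Continuous fun (f : SgHom (dualSemigroup σ) CQ) (i : Fin m) =>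
      f.1 ⟨(b i).1, perpLattice_le (b i).2⟩ := continuous_pi fun i => SgHom.continuous_apply _
  refine .of_comp ?_ h2 ?_
  · refine Continuous.subtype_mk (continuous_pi fun u => ?_) _
    by_cases hu : u.1 ∈ perpLattice σ
    · have : (fun g => (CQStar.orbitHom b g).1 u) =
          fun g => CQStar.incl (CQStar.character b g (.ofAdd ⟨u.1, hu⟩)) := by
        funext g
        exact SgHom.ofPerp_of_mem _ _ hu
      change Continuous fun g => (CQStar.orbitHom b g).1 u
      rw [this]
      refine CQStar.isEmbedding_incl.continuous.comp (Continuous.subtype_mk ?_ _)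
      refine continuous_pi fun k => continuous_finsetProd _ fun i _ => Continuous.zpow ?_ _
      exact (continuous_apply k).comp (continuous_subtype_val.comp (continuous_apply i))
    · have : (fun g => (CQStar.orbitHom b g).1 u) = fun g => CQ.zero := by
        funext g
        exact SgHom.ofPerp_of_notMem _ _ hu
      change Continuous fun g => (CQStar.orbitHom b g).1 u
      rw [this]
      exact continuous_const
  · convert h1 using 1
    funext g i
    exact CQStar.orbitHom_basis b g i

lemma CQStar.exists_orbitHom_eq {f : SgHom (dualSemigroup σ) CQ}
    (hf : ∀ u, IsUnit (f.1 u) ↔ u.1 ∈ perpLattice σ) : ∃ g, CQStar.orbitHom b g = f := by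
  choose g hg using fun i => CQStar.exists_incl_eq ((hf ⟨(b i).1, perpLattice_le (b i).2⟩).2 (b i).2)
  refine ⟨g, SgHom.ext_of_basis b (fun a => CQ.eq_zero_of_not_isUnit)
    (CQStar.isUnit_orbitHom_iff b g) hf fun i => ?_⟩
  rw [CQStar.orbitHom_basis, hg]

end Character

section Parametrization

variable {F : Fan n} (hF : F.HasIntegralFaces) {m : ℕ} {σ : F.cones}
  (b : Module.Basis (Fin m) ℤ (perpLattice σ.1))

include hF in
lemma Fan.HasIntegralFaces.isEmbedding_chart_orbitHom :
    Topology.IsEmbedding fun g => F.chart σ (CQStar.orbitHom b g) :=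
  (hF.isOpenEmbedding_chart CQ.hasOpenUnits σ).isEmbedding.comp (CQStar.isEmbedding_orbitHom b)

lemma Fan.range_chart_orbitHom :
    Set.range (fun g => F.chart σ (CQStar.orbitHom b g)) = F.stratum CQ σ := by
  ext x
  constructor
  · rintro ⟨g, rfl⟩
    exact ⟨_, CQStar.isUnit_orbitHom_iff b g, rfl⟩
  · rintro ⟨f, hf, rfl⟩
    obtain ⟨g, rfl⟩ := CQStar.exists_orbitHom_eq b hf
    exact ⟨g, rfl⟩

include hF in
lemma Fan.HasIntegralFaces.moment_chart_orbitHom_eq_iff {f : SgHom (dualSemigroup σ.1) ℝ≥0}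
    (hf : ∀ u, IsUnit (f.1 u) ↔ u.1 ∈ perpLattice σ.1) (g : Fin m → CQStar) :
    F.moment (F.chart σ (CQStar.orbitHom b g)) = F.chart σ f ↔
      ∀ i, ‖((g i).1 1 : ℂ)‖₊ = f.1 ⟨(b i).1, perpLattice_le (b i).2⟩ := by
  have hval : ∀ i, ((CQStar.orbitHom b g).comp CQ.abs).1 ⟨(b i).1, perpLattice_le (b i).2⟩ =
      ‖((g i).1 1 : ℂ)‖₊ := fun i => by
    rw [SgHom.comp_apply, CQStar.orbitHom_basis]
    rfl
  constructor
  · intro h i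
    rw [← hval, ← hF.chart_injective σ h]
  · intro h
    change F.chart σ ((CQStar.orbitHom b g).comp CQ.abs) = _
    congr 1
    refine SgHom.ext_of_basis b (z := 0) (fun a ha => by simpa [isUnit_iff_ne_zero] using ha)
      (fun u => (CQ.isUnit_abs_iff _).trans (CQStar.isUnit_orbitHom_iff b g u)) hf fun i => ?_
    rw [hval, h]

end Parametrization

/-! ### Polar coordinates -/

/-- The argument map `ℂ* → S¹`. -/
def unitsArg : ℂˣ →* Circle where
  toFun z := ⟨(z : ℂ) / (‖(z : ℂ)‖ : ℂ), by
    refine mem_sphere_zero_iff_norm.2 ?_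
    rw [norm_div, Complex.norm_real, norm_norm,
      div_self (norm_ne_zero_iff.2 z.ne_zero)]⟩
  map_one' := by ext; simp
  map_mul' z w := by
    ext
    change ((z * w : ℂˣ) : ℂ) / (‖((z * w : ℂˣ) : ℂ)‖ : ℂ) =
      (z : ℂ) / (‖(z : ℂ)‖ : ℂ) * ((w : ℂ) / (‖(w : ℂ)‖ : ℂ))
    rw [Units.val_mul, norm_mul, Complex.ofReal_mul, mul_div_mul_comm]

lemma coe_unitsArg (z : ℂˣ) : (unitsArg z : ℂ) = (z : ℂ) / (‖(z : ℂ)‖ : ℂ) := rfl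

lemma continuous_unitsArg : Continuous unitsArg := by
  refine Continuous.subtype_mk ?_ _
  refine Units.continuous_val.div₀ ?_ ?_
  · exact Complex.continuous_ofReal.comp (continuous_norm.comp Units.continuous_val)
  · intro z
    simp

/-- The compatible system of positive roots of a positive number. -/
def CQStar.root (r : ℝ) (hr : 0 < r) : CQStar :=
  ⟨fun k => Units.mk0 ((r ^ ((k : ℝ)⁻¹) : ℝ) : ℂ)
      (Complex.ofReal_ne_zero.2 (Real.rpow_pos_of_pos hr _).ne'), fun m k => by
    ext
    rw [Units.val_pow_eq_pow_val, Units.val_mk0, Units.val_mk0, ← Complex.ofReal_pow,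
      ← Real.rpow_natCast, ← Real.rpow_mul hr.le]
    congr 2
    have : ((k : ℕ) : ℝ) ≠ 0 := Nat.cast_ne_zero.2 k.ne_zero
    push_cast
    field_simp⟩

/-- The elements of `ℂ*_ℚ` over the circle of radius `r`. -/
def S1Q.scale (r : ℝ) (hr : 0 < r) (θ : S1Q) : CQStar :=
  powLimit.map Circle.toUnits θ * CQStar.root r hr

lemma S1Q.scale_apply (r : ℝ) (hr : 0 < r) (θ : S1Q) (k : ℕ+) :
    (((S1Q.scale r hr θ).1 k : ℂˣ) : ℂ) = (θ.1 k : ℂ) * ((r ^ ((k : ℝ)⁻¹) : ℝ) : ℂ) := rfl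

lemma S1Q.continuous_scale (r : ℝ) (hr : 0 < r) : Continuous (S1Q.scale r hr) := by
  refine Continuous.mul (powLimit.continuous_map ?_) continuous_const
  rw [Units.isEmbedding_val₀.continuous_iff]
  exact continuous_subtype_val

lemma S1Q.leftInverse_scale (r : ℝ) (hr : 0 < r) :
    Function.LeftInverse (powLimit.map unitsArg) (S1Q.scale r hr) := by
  intro θ
  apply Subtype.ext
  funext k
  apply Circle.ext
  change (unitsArg ((S1Q.scale r hr θ).1 k) : ℂ) = _
  have hk : 0 < r ^ ((k : ℝ)⁻¹) := Real.rpow_pos_of_pos hr _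
  rw [coe_unitsArg, S1Q.scale_apply, norm_mul, Circle.norm_coe, one_mul, Complex.norm_real,
    Real.norm_of_nonneg hk.le, mul_div_cancel_right₀ _ (Complex.ofReal_ne_zero.2 hk.ne')]

lemma S1Q.isEmbedding_scale (r : ℝ) (hr : 0 < r) : Topology.IsEmbedding (S1Q.scale r hr) :=
  (S1Q.leftInverse_scale r hr).isEmbedding (powLimit.continuous_map continuous_unitsArg)
    (S1Q.continuous_scale r hr)

lemma S1Q.norm_scale (r : ℝ) (hr : 0 < r) (θ : S1Q) :
    ‖(((S1Q.scale r hr θ).1 1 : ℂˣ) : ℂ)‖ = r := by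
  rw [S1Q.scale_apply, norm_mul, Circle.norm_coe, one_mul, Complex.norm_real]
  simp [abs_of_pos hr]

lemma S1Q.exists_scale_eq {r : ℝ} (hr : 0 < r) {g : CQStar} (hg : ‖((g.1 1 : ℂˣ) : ℂ)‖ = r) :
    ∃ θ, S1Q.scale r hr θ = g := by
  refine ⟨powLimit.map unitsArg g, ?_⟩
  apply Subtype.ext
  funext k
  apply Units.ext
  rw [S1Q.scale_apply]
  -- The modulus at level `1` fixes all others, because nonnegative roots are unique; only the
  -- arguments remain free.
  have hk : ‖((g.1 k : ℂˣ) : ℂ)‖ = r ^ ((k : ℝ)⁻¹) := by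
    have h := congrArg (fun z : ℂˣ => ‖(z : ℂ)‖) (g.2 1 k)
    simp only [one_mul, Units.val_pow_eq_pow_val, norm_pow, hg] at h
    rw [← h, Real.pow_rpow_inv_natCast (norm_nonneg _) k.ne_zero]
  change (unitsArg (g.1 k) : ℂ) * _ = _
  rw [coe_unitsArg, hk, div_mul_cancel₀]
  exact Complex.ofReal_ne_zero.2 (Real.rpow_pos_of_pos hr _).ne'

/-- The fibers of the moment map over the stratum of `σ` are products of solenoids. -/
lemma Fan.HasIntegralFaces.nonempty_fiber_homeomorph {F : Fan n} (hF : F.HasIntegralFaces) {m : ℕ}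
    {σ : F.cones} (b : Module.Basis (Fin m) ℤ (perpLattice σ.1)) {y : F.Delzant}
    (hy : y ∈ F.stratum ℝ≥0 σ) : Nonempty ((F.moment ⁻¹' {y}) ≃ₜ (Fin m → S1Q)) := by
  obtain ⟨f, hf, rfl⟩ := hy
  let r : Fin m → ℝ := fun i => f.1 ⟨(b i).1, perpLattice_le (b i).2⟩
  have hr : ∀ i, 0 < r i := fun i => NNReal.coe_pos.2
    (pos_iff_ne_zero.2 ((hf ⟨(b i).1, perpLattice_le (b i).2⟩).2 (b i).2).ne_zero)
  let e : (Fin m → S1Q) → F.XQ := fun θ =>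
    F.chart σ (CQStar.orbitHom b (Pi.map (fun i => S1Q.scale (r i) (hr i)) θ))
  have he : Topology.IsEmbedding e := (hF.isEmbedding_chart_orbitHom b).comp
    (.piMap fun i => S1Q.isEmbedding_scale (r i) (hr i))
  have hrange : F.moment ⁻¹' {F.chart σ f} = Set.range e := by
    ext x
    rw [Set.mem_preimage, Set.mem_singleton_iff]
    constructor
    · intro hx
      have hxs : x ∈ F.stratum CQ σ :=
        (hF.map_mem_stratum_iff CQ.isUnit_abs_iff).1 (show F.moment x ∈ _ from ⟨f, hf, hx⟩)
      rw [← Fan.range_chart_orbitHom b] at hxs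
      obtain ⟨g, rfl⟩ := hxs
      rw [hF.moment_chart_orbitHom_eq_iff b hf] at hx
      choose θ hθ using fun i => S1Q.exists_scale_eq (hr i) (g := g i)
        (by rw [← coe_nnnorm, hx i])
      exact ⟨θ, congrArg (fun g => F.chart σ (CQStar.orbitHom b g)) (funext hθ)⟩
    · rintro ⟨θ, rfl⟩
      rw [hF.moment_chart_orbitHom_eq_iff b hf]
      intro i
      apply NNReal.coe_injective
      rw [coe_nnnorm]
      exact S1Q.norm_scale (r i) (hr i) (θ i)
  exact ⟨(Homeomorph.setCongr hrange).trans he.toHomeomorph.symm⟩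

end

/-! ### Orbit closures, singular divisors and cusps. -/

section

variable {n : ℕ} {σ τ ρ : PointedCone ℝ (Fin n → ℝ)}

/-! ### Closures of torus orbits -/

lemma Fan.orbit_eq_stratum (F : Fan n) (σ : F.cones) : F.orbit σ.1 = F.stratum ℂ σ := by
  ext x
  constructor
  · rintro ⟨h, f, hf, rfl⟩
    exact ⟨f, fun u => isUnit_iff_ne_zero.trans (hf u), rfl⟩
  · rintro ⟨f, hf, rfl⟩
    exact ⟨σ.2, f, fun u => isUnit_iff_ne_zero.symm.trans (hf u), rfl⟩

/-- A rational cone contains a vector on which an element of `S^σ` vanishes only if it vanishes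
on `σ`. -/
lemma IsRational.exists_interior_vector (hσ : IsRational σ) :
    ∃ w ∈ σ, ∀ u ∈ dualSemigroup σ, toReal u ⬝ᵥ w = 0 → u ∈ perpLattice σ := by
  obtain ⟨s, hs⟩ := hσ
  refine ⟨∑ v ∈ s, toReal v, sum_mem fun v hv => generator_mem hs hv, fun u hu h w hw => ?_⟩
  rw [dotProduct_sum, Finset.sum_eq_zero_iff_of_nonneg
    (fun v hv => hu _ (generator_mem hs hv))] at h
  rw [hs] at hw
  induction hw using Submodule.span_induction with
  | mem w hw =>
    obtain ⟨v, hv, rfl⟩ := hw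
    exact h v hv
  | zero => simp
  | add a b _ _ ha hb => rw [dotProduct_add, ha, hb, add_zero]
  | smul c a _ ha =>
    have h : c • a = (c : ℝ) • a := rfl
    rw [h, dotProduct_smul, ha, smul_zero]

/-- The character `u ↦ exp (L u)` of `σ^⊥`. -/
def expCharacter (σ : PointedCone ℝ (Fin n → ℝ)) (L : (Fin n → ℤ) →+ ℂ) :
    Multiplicative (perpLattice σ) →* ℂ where
  toFun u := Complex.exp (L u.toAdd.1)
  map_one' := by
    change Complex.exp (L 0) = 1
    rw [map_zero, Complex.exp_zero]
  map_mul' u v := by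
    change Complex.exp (L (u.toAdd.1 + v.toAdd.1)) = _
    rw [map_add, Complex.exp_add]

/-- The homomorphism on `S^σ` given by `exp (L u)` on `σ^⊥` and by `0` elsewhere. -/
def expHom (σ : PointedCone ℝ (Fin n → ℝ)) (L : (Fin n → ℤ) →+ ℂ) : SgHom (dualSemigroup σ) ℂ :=
  SgHom.ofPerp (z := 0) zero_mul (expCharacter σ L)

lemma expHom_of_mem (L : (Fin n → ℤ) →+ ℂ) {u : dualSemigroup σ} (hu : u.1 ∈ perpLattice σ) :
    (expHom σ L).1 u = Complex.exp (L u.1) := SgHom.ofPerp_of_mem _ _ hu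

lemma expHom_of_notMem (L : (Fin n → ℤ) →+ ℂ) {u : dualSemigroup σ} (hu : u.1 ∉ perpLattice σ) :
    (expHom σ L).1 u = 0 := SgHom.ofPerp_of_notMem _ _ hu

lemma isUnit_expHom_iff (L : (Fin n → ℤ) →+ ℂ) (u : dualSemigroup σ) :
    IsUnit ((expHom σ L).1 u) ↔ u.1 ∈ perpLattice σ :=
  SgHom.isUnit_ofPerp_iff _ not_isUnit_zero _ u

/-- The points of a stratum of the toric variety have a logarithm. -/
lemma exists_expHom_eq {f : SgHom (dualSemigroup σ) ℂ}
    (hf : ∀ u, IsUnit (f.1 u) ↔ u.1 ∈ perpLattice σ) : ∃ L, expHom σ L = f := by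
  have : Module.Finite ℤ (perpLattice σ) :=
    inferInstanceAs (Module.Finite ℤ (perpLattice σ).toIntSubmodule)
  have : Module.Free ℤ (perpLattice σ) :=
    inferInstanceAs (Module.Free ℤ (perpLattice σ).toIntSubmodule)
  let b := Module.finBasis ℤ (perpLattice σ)
  have hli := linearIndependent_toReal b
  -- Logarithms are chosen freely on a basis of `σ^⊥` and extended real-linearly to the whole space,
  -- so that `L` also makes sense off `σ^⊥`.
  obtain ⟨L, hL⟩ := LinearMap.exists_extend ((Module.Basis.span hli).constr ℝ
    fun i => Complex.log (f.1 ⟨(b i).1, perpLattice_le (b i).2⟩))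
  have hLb : ∀ i, L (toReal (b i).1) = Complex.log (f.1 ⟨(b i).1, perpLattice_le (b i).2⟩) := by
    intro i
    have h := LinearMap.congr_fun hL (Module.Basis.span hli i)
    rw [Module.Basis.constr_basis, LinearMap.comp_apply, Submodule.subtype_apply,
      Module.Basis.span_apply] at h
    exact h
  refine ⟨L.toAddMonoidHom.comp toRealHom, SgHom.ext_of_basis b (z := 0)
    (fun a ha => by simpa [isUnit_iff_ne_zero] using ha) (isUnit_expHom_iff _) hf fun i => ?_⟩
  have hu : ((⟨(b i).1, perpLattice_le (b i).2⟩ : dualSemigroup σ) : Fin n → ℤ) ∈ perpLattice σ :=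
    (b i).2
  rw [expHom_of_mem _ hu]
  change Complex.exp (L (toReal (b i).1)) = _
  rw [hLb, Complex.exp_log ((hf _).2 hu).ne_zero]

/-- The strata of the cones containing `ρ` form a closed set. -/
lemma Fan.HasIntegralFaces.isClosed_biUnion_stratum {F : Fan n} (hF : F.HasIntegralFaces)
    (ρ : F.cones) : IsClosed (⋃ τ : F.cones, ⋃ (_ : ρ.1 ≤ τ.1), F.stratum ℂ τ) := by
  rw [F.isClosed_iff]
  intro σ
  -- In a chart, membership is the vanishing of all coordinates outside `ρ^⊥`, a closed condition.
  have key : ∀ f : SgHom (dualSemigroup σ.1) ℂ,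
      F.chart σ f ∈ (⋃ τ : F.cones, ⋃ (_ : ρ.1 ≤ τ.1), F.stratum ℂ τ) ↔
        ρ.1 ≤ σ.1 ∧ ∀ u : dualSemigroup σ.1, u.1 ∉ perpLattice ρ.1 → f.1 u = 0 := by
    intro f
    obtain ⟨τ, hτσ, hτ, hiff⟩ := F.exists_chart_mem_stratum σ f
    simp only [Set.mem_iUnion, exists_prop]
    constructor
    · rintro ⟨τ', hρ, hτ'⟩
      obtain rfl := hF.eq_of_mem_stratum hτ hτ'
      refine ⟨hρ.trans hτσ, fun u hu => ?_⟩
      by_contra h0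
      exact hu fun w hw => (hiff u).1 (isUnit_iff_ne_zero.2 h0) w (hρ hw)
    · rintro ⟨hρ, h0⟩
      refine ⟨τ, fun w hw => ?_, hτ⟩
      obtain ⟨u₀, hu₀⟩ := hF σ.1 σ.2 τ.1 τ.2 hτσ
      refine (hu₀.mem_iff w).2 ⟨hρ hw, ?_⟩
      by_contra hne
      exact ((hiff ⟨u₀, hu₀.mem⟩).2 hu₀.mem_perpLattice).ne_zero (h0 _ fun h => hne (h w hw))
  by_cases hρ : ρ.1 ≤ σ.1
  · have : F.chart σ ⁻¹' (⋃ τ : F.cones, ⋃ (_ : ρ.1 ≤ τ.1), F.stratum ℂ τ) =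
        ⋂ (u : dualSemigroup σ.1) (_ : u.1 ∉ perpLattice ρ.1), {f | f.1 u = 0} := by
      ext f
      rw [Set.mem_preimage, key]
      simp [hρ]
    rw [this]
    exact isClosed_iInter fun u => isClosed_iInter fun _ =>
      isClosed_eq (SgHom.continuous_apply u) continuous_const
  · have : F.chart σ ⁻¹' (⋃ τ : F.cones, ⋃ (_ : ρ.1 ≤ τ.1), F.stratum ℂ τ) = ∅ := by
      ext f
      rw [Set.mem_preimage, key]
      simp [hρ]
    rw [this]
    exact isClosed_empty

/-- A one-parameter degeneration: for `w` positive on `S^τ` off `τ^⊥`, the points `exp (L u - k ⟨u,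
w⟩)` of the stratum of `ρ` keep their values on `τ^⊥` and tend to `0` elsewhere as `k → ∞`. -/
lemma Fan.stratum_subset_closure (F : Fan n) {ρ τ : F.cones} (h : ρ.1 ≤ τ.1) :
    F.stratum ℂ τ ⊆ closure (F.stratum ℂ ρ) := by
  rintro _ ⟨f, hf, rfl⟩
  obtain ⟨L, rfl⟩ := exists_expHom_eq hf
  obtain ⟨w, hw, hwτ⟩ := (F.isRational τ).exists_interior_vector
  let D : (Fin n → ℤ) →+ ℂ :=
    { toFun := fun u => ((toReal u ⬝ᵥ w : ℝ) : ℂ)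
      map_zero' := by simp [toReal_zero]
      map_add' := fun u v => by rw [toReal_add, add_dotProduct, Complex.ofReal_add] }
  let g : ℕ → SgHom (dualSemigroup ρ.1) ℂ := fun k => expHom ρ.1 (L - k • D)
  have hlim : Filter.Tendsto (fun k => (g k).restrict (dualSemigroup_anti h)) Filter.atTop
      (nhds (expHom τ.1 L)) := by
    rw [tendsto_subtype_rng, tendsto_pi_nhds]
    intro u
    by_cases hρ : u.1 ∈ perpLattice ρ.1
    · have hval : ∀ k, ((g k).restrict (dualSemigroup_anti h)).1 u =
          Complex.exp (L u.1 - k * ((toReal u.1 ⬝ᵥ w : ℝ) : ℂ)) := by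
        intro k
        rw [SgHom.restrict_apply, expHom_of_mem _ hρ]
        congr 1
        simp [D]
      simp only [hval]
      by_cases hτ : u.1 ∈ perpLattice τ.1
      · rw [expHom_of_mem _ hτ]
        simp only [hτ w hw, Complex.ofReal_zero, mul_zero, sub_zero]
        exact tendsto_const_nhds
      · rw [expHom_of_notMem _ hτ]
        have hpos : 0 < toReal u.1 ⬝ᵥ w :=
          lt_of_le_of_ne (u.2 w hw) fun h0 => hτ (hwτ u.1 u.2 h0.symm)
        rw [tendsto_zero_iff_norm_tendsto_zero]
        simp only [Complex.norm_exp]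
        refine Real.tendsto_exp_atBot.comp ?_
        have : ∀ k : ℕ, (L u.1 - k * ((toReal u.1 ⬝ᵥ w : ℝ) : ℂ)).re =
            (L u.1).re - k * (toReal u.1 ⬝ᵥ w) := fun k => by simp
        simp only [this]
        simp only [sub_eq_add_neg]
        refine Filter.tendsto_atBot_add_const_left _ _ (Filter.tendsto_neg_atTop_atBot.comp ?_)
        exact tendsto_natCast_atTop_atTop.atTop_mul_const hpos
    · have hτ : u.1 ∉ perpLattice τ.1 := fun h' => hρ fun w hw => h' w (h hw)
      have hval : ∀ k, ((g k).restrict (dualSemigroup_anti h)).1 u = 0 := fun k => by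
        rw [SgHom.restrict_apply, expHom_of_notMem _ hρ]
      simp only [hval]
      rw [expHom_of_notMem _ hτ]
      exact tendsto_const_nhds
  refine mem_closure_of_tendsto ((F.continuous_chart τ).continuousAt.tendsto.comp hlim)
    (Filter.Eventually.of_forall fun k => ?_)
  rw [Function.comp_apply, F.chart_restrict h]
  exact ⟨_, isUnit_expHom_iff _, rfl⟩

/-- The orbit closure of `ρ` is the union of the strata of the cones containing `ρ`. -/
lemma Fan.HasIntegralFaces.mem_divisor_iff {F : Fan n} (hF : F.HasIntegralFaces) {ρ τ : F.cones}
    {x : F.X} (hx : x ∈ F.stratum ℂ τ) : x ∈ F.divisor ρ.1 ↔ ρ.1 ≤ τ.1 := by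
  rw [Fan.divisor, F.orbit_eq_stratum ρ]
  refine ⟨fun h => ?_, fun h => F.stratum_subset_closure h hx⟩
  have hsub : F.stratum ℂ ρ ⊆ ⋃ τ : F.cones, ⋃ (_ : ρ.1 ≤ τ.1), F.stratum ℂ τ :=
    Set.subset_iUnion₂_of_subset ρ le_rfl subset_rfl
  have h' := closure_minimal hsub (hF.isClosed_biUnion_stratum ρ) h
  simp only [Set.mem_iUnion, exists_prop] at h'
  obtain ⟨τ', hρ, hτ'⟩ := h'
  exact hF.eq_of_mem_stratum hx hτ' ▸ hρ

/-! ### The moment map with values in the polytope -/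

section PolytopeMoment

variable {F : Fan n} {P : LatticePolytope n} (hF : F.IsNormalFan P) {m m' : ℕ}
  {Q Q' : Set (Fin n → ℝ)}

lemma Fan.polytopeMoment_mem_intrinsicInterior_iff (hQ : P.IsFace m Q) {x : F.XQ} :
    F.polytopeMoment P hF x ∈ intrinsicInterior ℝ Q ↔
      x ∈ F.stratum CQ ⟨P.normalCone Q, hF.mem_cones hQ⟩ :=
  (F.toPolytope_mem_intrinsicInterior_iff hF hQ).trans
    (hF.hasIntegralFaces.map_mem_stratum_iff CQ.isUnit_abs_iff)

lemma Fan.polytopeMoment_mem_iff (hQ : P.IsFace m Q) {x : F.XQ} {τ : F.cones}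
    (hx : x ∈ F.stratum CQ τ) : F.polytopeMoment P hF x ∈ Q ↔ P.normalCone Q ≤ τ.1 :=
  F.toPolytope_mem_iff hF hQ (F.map_mem_stratum CQ.isUnit_abs_iff hx)

/-- Both sides are the union of the strata of the cones containing the normal cone of `Q`; no
restriction on the dimension of `Q` is needed. -/
lemma Fan.polytopeMoment_preimage_face (hQ : P.IsFace m Q) :
    F.polytopeMoment P hF ⁻¹' Q = F.singularDivisor (P.normalCone Q) := by
  ext x
  obtain ⟨τ, hτ⟩ := F.exists_mem_stratum x
  rw [Set.mem_preimage, F.polytopeMoment_mem_iff hF hQ hτ]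
  exact (hF.hasIntegralFaces.mem_divisor_iff (ρ := ⟨P.normalCone Q, hF.mem_cones hQ⟩)
    (F.map_mem_stratum CQ.isUnit_proj₁_iff hτ)).symm

/-- One test point in the stratum of `Q` decides the inclusion. This gives injectivity on facets. -/
lemma Fan.subset_of_polytopeMoment_preimage_subset (hQ : P.IsFace m Q) (hQ' : P.IsFace m' Q')
    (h : F.polytopeMoment P hF ⁻¹' Q ⊆ F.polytopeMoment P hF ⁻¹' Q') : Q ⊆ Q' := by
  obtain ⟨x, hx⟩ := F.stratum_nonempty CQ.zero_mul CQ.not_isUnit_zero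
    ⟨P.normalCone Q, hF.mem_cones hQ⟩
  have hxQ : F.polytopeMoment P hF x ∈ Q := (F.polytopeMoment_mem_iff hF hQ hx).2 le_rfl
  exact (hQ.normalCone_le_iff hQ').1 ((F.polytopeMoment_mem_iff hF hQ' hx).1 (h hxQ))

lemma Fan.exists_orbit_homeomorph (hQ : P.IsFace m Q) :
    ∃ (hσ : P.normalCone Q ∈ F.cones)
      (b : Module.Basis (Fin m) ℤ (perpLattice (P.normalCone Q)))
      (Φ : (F.polytopeMoment P hF ⁻¹' intrinsicInterior ℝ Q) ≃ₜ (Fin m → CQStar)),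
      ∀ x, ∃ f : SgHom (dualSemigroup (P.normalCone Q)) CQ,
        x.1 = F.chart ⟨P.normalCone Q, hσ⟩ f ∧
        ∀ i, CQStar.incl (Φ x i) = f.1 ⟨(b i).1, perpLattice_le (b i).2⟩ := by
  have hσ := hF.mem_cones hQ
  obtain ⟨b⟩ := hQ.nonempty_basis
  have he := hF.hasIntegralFaces.isEmbedding_chart_orbitHom (σ := ⟨P.normalCone Q, hσ⟩) b
  have hrange : F.polytopeMoment P hF ⁻¹' intrinsicInterior ℝ Q =
      Set.range fun g => F.chart ⟨P.normalCone Q, hσ⟩ (CQStar.orbitHom b g) := by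
    rw [F.range_chart_orbitHom]
    ext x
    exact F.polytopeMoment_mem_intrinsicInterior_iff hF hQ
  refine ⟨hσ, b, (Homeomorph.setCongr hrange).trans he.toHomeomorph.symm, fun x => ?_⟩
  set g := (Homeomorph.setCongr hrange).trans he.toHomeomorph.symm x with hg
  refine ⟨CQStar.orbitHom b g, ?_, fun i => (CQStar.orbitHom_basis b g i).symm⟩
  have h : he.toHomeomorph g = Homeomorph.setCongr hrange x := by
    rw [hg, Homeomorph.trans_apply, Homeomorph.apply_symm_apply]
  exact (congrArg Subtype.val h).symm

/-! ### Cusps -/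

lemma LatticePolytope.isFace_singleton {v : Fin n → ℝ} (hv : v ∈ P.carrier.exposedPoints ℝ) :
    P.IsFace 0 {v} := by
  refine ⟨Set.singleton_nonempty v, mem_exposedPoints_iff_exposed_singleton.1 hv, ?_⟩
  rw [vectorSpan_singleton, finrank_bot]

lemma LatticePolytope.IsFace.eq_singleton (hQ : P.IsFace 0 Q) {v : Fin n → ℝ} (hv : v ∈ Q) :
    Q = {v} := by
  have h : vectorSpan ℝ Q = ⊥ := Submodule.finrank_eq_zero.1 hQ.2.2
  exact ((vectorSpan_eq_bot_iff_subsingleton ℝ).1 h).eq_singleton_of_mem hv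

lemma LatticePolytope.finite_exposedPoints (P : LatticePolytope n) :
    (P.carrier.exposedPoints ℝ).Finite := by
  refine (P.points.finite_toSet.image toReal).subset fun v hv => ?_
  have hQ := LatticePolytope.isFace_singleton hv
  obtain ⟨a, ha⟩ := hQ.facePoints_nonempty
  obtain ⟨ha, hav⟩ := LatticePolytope.mem_facePoints.1 ha
  exact ⟨a, ha, hav⟩

lemma LatticePolytope.IsFace.eq_zero_of_mem_perpLattice (hQ : P.IsFace 0 Q) {u : Fin n → ℤ}
    (hu : u ∈ perpLattice (P.normalCone Q)) : u = 0 := by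
  obtain ⟨b⟩ := hQ.nonempty_basis
  have := b.repr.toEquiv.subsingleton
  exact congrArg Subtype.val (Subsingleton.elim (⟨u, hu⟩ : perpLattice (P.normalCone Q)) 0)

lemma Fan.stratum_subsingleton (hQ : P.IsFace 0 Q) :
    (F.stratum CQ ⟨P.normalCone Q, hF.mem_cones hQ⟩).Subsingleton := by
  obtain ⟨b⟩ := hQ.nonempty_basis
  rw [← F.range_chart_orbitHom b]
  exact Set.subsingleton_range _

/-- The cusps are the points of the strata of the vertices. -/
lemma Fan.mem_cusps_iff {x : F.XQ} : x ∈ F.cusps ↔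
    ∃ (v : Fin n → ℝ) (hv : v ∈ P.carrier.exposedPoints ℝ),
      x ∈ F.stratum CQ
        ⟨P.normalCone {v}, hF.mem_cones (LatticePolytope.isFace_singleton hv)⟩ := by
  constructor
  · rintro ⟨σ, p, hp, hx⟩
    obtain ⟨τ, hτσ, hτ, hiff⟩ := F.exists_chart_mem_stratum σ p
    obtain ⟨u₀, hu₀⟩ := hF.hasIntegralFaces σ.1 σ.2 τ.1 τ.2 hτσ
    have hzero : ∀ u : dualSemigroup σ.1, u.1 ∈ perpLattice τ.1 → u.1 = 0 := by
      intro u hu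
      by_contra h
      exact ((hiff u).2 hu).ne_zero (hp u fun h0 => h (congrArg Subtype.val h0))
    -- As `τ` is cut out by `0`, it is `σ` itself, and its orthogonal lattice is trivial.
    have hu₀0 : u₀ = 0 := hzero ⟨u₀, hu₀.mem⟩ hu₀.mem_perpLattice
    have hperp : ∀ u ∈ perpLattice τ.1, u = 0 := by
      intro u hu
      obtain ⟨N, hN⟩ := hu₀.exists_add_nsmul_mem (F.isRational σ) (perpLattice_le hu)
      rw [hu₀0, smul_zero, add_zero] at hN
      exact hzero ⟨u, hN⟩ hu
    rw [← hx] at hτ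
    replace hτ := (hF.hasIntegralFaces.map_mem_stratum_iff CQ.isUnit_proj₁_iff).1 hτ
    obtain ⟨τ, hτF⟩ := τ
    obtain ⟨m, Q, hQ, rfl⟩ := hF.exists_face ⟨τ, hτF⟩
    obtain ⟨b⟩ := hQ.nonempty_basis
    have hm : m = 0 := by
      by_contra h
      exact b.ne_zero ⟨0, Nat.pos_of_ne_zero h⟩ (Subtype.ext (hperp _ (b _).2))
    subst hm
    obtain ⟨v, hv⟩ := hQ.1
    obtain rfl := hQ.eq_singleton hv
    exact ⟨v, mem_exposedPoints_iff_exposed_singleton.2 hQ.2.1, hτ⟩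
  · rintro ⟨v, hv, f, hf, rfl⟩
    -- The image of the point under `q₁` is itself the special point, since the orthogonal lattice
    -- of a vertex cone is zero.
    refine ⟨_, f.comp (powLimit.proj₁ ℂ), fun u hu => ?_, rfl⟩
    by_contra h
    have h1 : IsUnit (f.1 u) := (CQ.isUnit_proj₁_iff _).1 (isUnit_iff_ne_zero.2 h)
    exact hu (Subtype.ext ((LatticePolytope.isFace_singleton hv).eq_zero_of_mem_perpLattice
      ((hf u).1 h1)))

lemma Fan.polytopeMoment_eq_iff {v : Fin n → ℝ} (hv : v ∈ P.carrier.exposedPoints ℝ) {x : F.XQ} :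
    F.polytopeMoment P hF x = v ↔ x ∈ F.stratum CQ
      ⟨P.normalCone {v}, hF.mem_cones (LatticePolytope.isFace_singleton hv)⟩ := by
  rw [← F.polytopeMoment_mem_intrinsicInterior_iff hF (LatticePolytope.isFace_singleton hv),
    intrinsicInterior_singleton, Set.mem_singleton_iff]

lemma Fan.bijOn_cusps :
    Set.BijOn (F.polytopeMoment P hF) F.cusps (P.carrier.exposedPoints ℝ) := by
  refine ⟨fun x hx => ?_, fun x hx x' _ h => ?_, fun v hv => ?_⟩
  · obtain ⟨v, hv, hxv⟩ := (F.mem_cusps_iff hF).1 hx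
    rwa [(F.polytopeMoment_eq_iff hF hv).2 hxv]
  · obtain ⟨v, hv, hxv⟩ := (F.mem_cusps_iff hF).1 hx
    have hx' : F.polytopeMoment P hF x' = v := by
      rw [← h, (F.polytopeMoment_eq_iff hF hv).2 hxv]
    exact F.stratum_subsingleton hF (LatticePolytope.isFace_singleton hv) hxv
      ((F.polytopeMoment_eq_iff hF hv).1 hx')
  · obtain ⟨x, hx⟩ := F.stratum_nonempty CQ.zero_mul CQ.not_isUnit_zero
      ⟨P.normalCone {v}, hF.mem_cones (LatticePolytope.isFace_singleton hv)⟩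
    exact ⟨x, (F.mem_cusps_iff hF).2 ⟨v, hv, hx⟩, (F.polytopeMoment_eq_iff hF hv).2 hx⟩

end PolytopeMoment

end

end ProToric

end

/-! ### Assembly of the three statements. -/

open ProToric in
theorem mainTheorem6 {n : ℕ} (F : Fan n) (P : LatticePolytope n) (hF : F.IsNormalFan P) :
    (∀ (m : ℕ) (Q : Set (Fin n → ℝ)), P.IsFace m Q →
      (∃ (hσ : P.normalCone Q ∈ F.cones)
        (b : Module.Basis (Fin m) ℤ (perpLattice (P.normalCone Q)))
        (Φ : (F.polytopeMoment P hF ⁻¹' intrinsicInterior ℝ Q) ≃ₜ (Fin m → CQStar)),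
        ∀ x, ∃ f : SgHom (dualSemigroup (P.normalCone Q)) CQ,
          x.1 = F.chart ⟨P.normalCone Q, hσ⟩ f ∧
          ∀ i, CQStar.incl (Φ x i) = f.1 ⟨(b i).1, perpLattice_le (b i).2⟩) ∧
      ∀ y : F.Delzant, F.toPolytope P hF y ∈ intrinsicInterior ℝ Q →
        Nonempty ((F.moment ⁻¹' {y}) ≃ₜ (Fin m → S1Q))) ∧
    (Set.BijOn (fun Q => F.polytopeMoment P hF ⁻¹' Q) {Q | ∃ m, m + 1 = n ∧ P.IsFace m Q}
        (F.singularDivisor '' F.rays) ∧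
      ∀ m Q, m + 1 = n → P.IsFace m Q →
        P.normalCone Q ∈ F.rays ∧
        F.polytopeMoment P hF ⁻¹' Q = F.singularDivisor (P.normalCone Q)) ∧
    (Set.BijOn (F.polytopeMoment P hF) F.cusps (P.carrier.exposedPoints ℝ) ∧
      F.cusps.Finite ∧ F.cusps.ncard = (P.carrier.exposedPoints ℝ).ncard) := by
  have hray : ∀ m Q, m + 1 = n → P.IsFace m Q → P.normalCone Q ∈ F.rays := fun m Q hm hQ =>
    ⟨hF.mem_cones hQ, by have := hQ.coneDim_add; omega⟩
  have hbij := F.bijOn_cusps hF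
  refine ⟨fun m Q hQ => ⟨F.exists_orbit_homeomorph hF hQ, fun y hy => ?_⟩,
    ⟨⟨?_, ?_, ?_⟩, fun m Q hm hQ => ⟨hray m Q hm hQ, F.polytopeMoment_preimage_face hF hQ⟩⟩,
    hbij, ?_, ?_⟩
  · obtain ⟨b⟩ := hQ.nonempty_basis
    exact hF.hasIntegralFaces.nonempty_fiber_homeomorph
      (σ := ⟨P.normalCone Q, hF.mem_cones hQ⟩) b
      ((F.toPolytope_mem_intrinsicInterior_iff hF hQ).1 hy)
  · rintro Q ⟨m, hm, hQ⟩
    exact ⟨_, hray m Q hm hQ, (F.polytopeMoment_preimage_face hF hQ).symm⟩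
  · rintro Q ⟨m, -, hQ⟩ Q' ⟨m', -, hQ'⟩ h
    exact subset_antisymm (F.subset_of_polytopeMoment_preimage_subset hF hQ hQ' h.subset)
      (F.subset_of_polytopeMoment_preimage_subset hF hQ' hQ h.superset)
  -- Every ray is the normal cone of some face, and `coneDim_add` forces that face to have
  -- codimension one.
  · rintro _ ⟨ρ, ⟨hρ, hdim⟩, rfl⟩
    obtain ⟨m, Q, hQ, rfl⟩ := hF.exists_face ⟨ρ, hρ⟩
    exact ⟨Q, ⟨m, by have := hQ.coneDim_add; omega, hQ⟩, F.polytopeMoment_preimage_face hF hQ⟩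
  · exact Set.Finite.of_finite_image (hbij.image_eq ▸ P.finite_exposedPoints) hbij.injOn
  · rw [← hbij.image_eq, hbij.injOn.ncard_image]
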